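/- For $n\ge 0$ let $\mathfrak S_n$ be the set of permutations $\sigma=\sigma_1\cdots\sigma_n$ of $[n]=\{1,\dots,n\}$. A permutation $\sigma\in\mathfrak S_n$ contains $\pi\in\mathfrak S_k$ as a pattern if some subsequence of $\sigma$ of length $k$ is in the same relative order as $\pi$; otherwise $\sigma$ avoids $\pi$. For $S\subseteq[n-1]$ let $$F_S=\sum x_{i_1}x_{i_2}\cdots x_{i_n}\in\mathbb R[[x_1,x_2,\dots]],$$ where the sum is over all indices $i_1\le i_2\le\cdots\le i_n$ with $i_j<i_{j+1}$ whenever $j\in S$, and let $\operatorname{Des}\sigma=\{j\in[n-1] : \sigma_j>\sigma_{j+1}\}$. For a set $\Pi\subseteq\mathfrak S_k$ put $$Q_n(\Pi)=\sum_{\sigma} F_{\operatorname{Des}\sigma},$$ the sum being over all $\sigma\in\mathfrak S_n$ that avoid every element of $\Pi$. A power series is called symmetric if it is of bounded degree and invariant under all permutations of the variables. Let $\iota_k=12\cdots k$ and $\delta_k=k\cdots21$ be the increasing and the decreasing permutation in $\mathfrak S_k$. **Theorem.** Let $k\ge4$ and let $\Pi\subseteq\mathfrak S_k$ with $\#\Pi=2$.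 Then $Q_n(\Pi)$ is symmetric for all $n\ge0$ if and only if $\Pi=\{\iota_k,\delta_k\}$. -/

import Mathlib

namespace PatternQSym

/-- `σ ∈ 𝔖ₙ` contains `π ∈ 𝔖ₖ` as a pattern: some subsequence of `σ` (at the positions
`f 0 < f 1 < ⋯`) is in the same relative order as `π`, i.e. has standardization `π`. -/
def Contains {k n : ℕ} (σ : Equiv.Perm (Fin n)) (π : Equiv.Perm (Fin k)) : Prop :=
  ∃ f : Fin k ↪o Fin n, ∀ a b : Fin k, π a < π b ↔ σ (f a) < σ (f b)

/-- `σ` avoids every permutation in `P`. -/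
def Avoids {k n : ℕ} (σ : Equiv.Perm (Fin n)) (P : Finset (Equiv.Perm (Fin k))) : Prop :=
  ∀ π ∈ P, ¬ Contains σ π

/-- The descent set of a permutation. Positions are counted from `0`: the element `j : Fin (n - 1)`
stands for the pair of adjacent positions `j`, `j + 1`, hence for the number `j + 1` of `[n - 1]`. -/
def Des {n : ℕ} (σ : Equiv.Perm (Fin n)) : Set (Fin (n - 1)) :=
  {j | σ ⟨j + 1, by omega⟩ < σ ⟨j, by omega⟩}

/-- The index sequences `i₁ ≤ i₂ ≤ ⋯ ≤ iₙ`, with `i_j < i_{j+1}` for `j ∈ S`, such that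
`x_{i₁} x_{i₂} ⋯ x_{iₙ}` is the monomial with exponent vector `d`. -/
def indexSeqs (n : ℕ) (S : Set (Fin (n - 1))) (d : ℕ →₀ ℕ) : Set (Fin n → ℕ) :=
  {i | Monotone i ∧ (∀ j ∈ S, i ⟨j, by omega⟩ < i ⟨j + 1, by omega⟩) ∧
    ∑ j, Finsupp.single (i j) 1 = d}

theorem indexSeqs_finite (n : ℕ) (S : Set (Fin (n - 1))) (d : ℕ →₀ ℕ) :
    (indexSeqs n S d).Finite := by
  refine (Set.Finite.pi' (fun _ : Fin n => d.support.finite_toSet)).subset ?_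
  rintro i ⟨-, -, rfl⟩ j
  simp only [Finset.mem_coe, Finsupp.mem_support_iff, Finsupp.finsetSum_apply]
  intro h
  have := (Finset.sum_eq_zero_iff.mp h) j (Finset.mem_univ j)
  simp at this

/-- The fundamental quasisymmetric function `F_S = ∑ x_{i₁} x_{i₂} ⋯ x_{iₙ}`, as a formal power
series over `ℝ` in countably many variables: its coefficient at a monomial is the number of terms
of the sum that are equal to this monomial. -/
noncomputable def fundamental (n : ℕ) (S : Set (Fin (n - 1))) : MvPowerSeries ℕ ℝ :=
  fun d => ((indexSeqs n S d).ncard : ℝ)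

open Classical in
/-- `Qₙ(P)`, the sum of `F_{Des σ}` over all `σ ∈ 𝔖ₙ` that avoid `P`. -/
noncomputable def Q (n : ℕ) {k : ℕ} (P : Finset (Equiv.Perm (Fin k))) : MvPowerSeries ℕ ℝ :=
  ∑ σ : Equiv.Perm (Fin n) with Avoids σ P, fundamental n (Des σ)

/-- Symmetric functions: power series of bounded degree that are invariant under all
permutations of the variables. -/
def IsSymmetricFunction (f : MvPowerSeries ℕ ℝ) : Prop :=
  (∃ N : ℕ, ∀ d : ℕ →₀ ℕ, N < d.degree → MvPowerSeries.coeff d f = 0) ∧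
    ∀ e : Equiv.Perm ℕ, MvPowerSeries.renameEquiv (R := ℝ) e f = f

/-- The increasing permutation `ι_k = 12⋯k`. -/
def increasing (k : ℕ) : Equiv.Perm (Fin k) := Equiv.refl (Fin k)

/-- The decreasing permutation `δ_k = k⋯21`. -/
def decreasing (k : ℕ) : Equiv.Perm (Fin k) := Fin.revPerm

end PatternQSym

/-! The coefficient of `Q n P` at a monomial counts the words `w` with that content whose sorting
permutation `Tuple.sort w`, the inverse of the standardization of `w`, avoids `P`
(`coeff_Q_eq_ncard`). Symmetry says that this count is unchanged when the letters are permuted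
(`isSymmetricFunction_Q_iff`).

Sufficiency. The patterns ι_k and δ_k are their own inverses, so `Tuple.sort w` avoids both exactly
when `w` has neither a weakly increasing nor a strictly decreasing subsequence of length k. Under
RSK this bounds the first row and the first column of the shape of `w`, and crystal operators
preserve the shape. The proof bypasses RSK: it shows directly that raising the last unbracketed `a`
to `a + 1` preserves both properties (`RaisesAt.noLongMonotone_iff`). Iterated raising then matches
the words of two contents that differ by exchanging the multiplicities of `a` and `a + 1`
(`numNoLongMonotone_swap_of_le`), and adjacent transpositions generate the rest.

Necessity. In degree k the avoiders are all permutations other than p and q, and the sum over all of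
𝔖_k is symmetric, so F_{Des p} + F_{Des q} is symmetric. Comparing a few coefficients
(`pair_single`, `pair_adjacent`, `pair_distant`) forces one descent set to be empty and the other
full, with one exception: for k = 4 the descent sets {1,3} and {2} give the Schur function s_{22}.
That case is excluded by a finite computation in degrees 5 and 6 (`exists_countAvoiding_ne`). -/

namespace PatternQSym

open Equiv

/-! ### Coefficients of `Q n P` as numbers of words -/

/-- The exponent vector of the monomial `∏ x_{w j}`. -/
noncomputable def content {n : ℕ} (w : Fin n → ℕ) : ℕ →₀ ℕ := ∑ j, Finsupp.single (w j) 1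

theorem content_apply {n : ℕ} (w : Fin n → ℕ) (v : ℕ) :
    content w v = (Finset.univ.filter fun j => w j = v).card := by
  simp [content, Finsupp.finsetSum_apply, Finsupp.single_apply]

theorem content_apply_eq_count {n : ℕ} (w : Fin n → ℕ) (v : ℕ) :
    content w v = (List.ofFn w).count v := by
  induction n with
  | zero => simp [content]
  | succ n ih =>
    rw [List.ofFn_succ, List.count_cons, ← ih (fun i => w i.succ)]
    simp [content, Fin.sum_univ_succ, Finsupp.single_apply, add_comm]

theorem content_eq_iff_perm {n : ℕ} {w w' : Fin n → ℕ} :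
    content w = content w' ↔ (List.ofFn w).Perm (List.ofFn w') := by
  simp only [List.perm_iff_count, ← content_apply_eq_count, Finsupp.ext_iff]

theorem content_comp_perm {n : ℕ} (w : Fin n → ℕ) (ρ : Perm (Fin n)) :
    content (w ∘ ρ) = content w :=
  Equiv.sum_comp ρ fun j => Finsupp.single (w j) 1

theorem content_comp_left {n : ℕ} (e : ℕ ↪ ℕ) (w : Fin n → ℕ) :
    content (e ∘ w) = (content w).embDomain e := by
  simp [content, Finsupp.embDomain_eq_mapDomain, Finsupp.mapDomain_finsetSum]

theorem content_comp_eq_iff {n : ℕ} (e : Perm ℕ) (w w' : Fin n → ℕ) :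
    content (e ∘ w) = content (e ∘ w') ↔ content w = content w' := by
  have := content_comp_left (n := n) e.toEmbedding
  simp only [Equiv.coe_toEmbedding] at this
  rw [this, this, (Finsupp.embDomain_injective _).eq_iff]

theorem eq_of_monotone_of_content_eq {n : ℕ} {w w' : Fin n → ℕ} (hw : Monotone w)
    (hw' : Monotone w') (h : content w = content w') : w = w' := by
  have := (content_eq_iff_perm.mp h).eq_of_pairwise (le := (· ≤ ·))
    (fun _ _ _ _ => le_antisymm)
    (List.pairwise_ofFn.mpr fun i j hij => hw hij.le)
    (List.pairwise_ofFn.mpr fun i j hij => hw' hij.le)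
  exact List.ofFn_injective this

theorem degree_content {n : ℕ} (w : Fin n → ℕ) : (content w).degree = n := by
  simp [content, map_sum, Finsupp.degree_single]

theorem finite_content_eq {n : ℕ} (d : ℕ →₀ ℕ) : {w : Fin n → ℕ | content w = d}.Finite := by
  refine (Set.Finite.pi' (fun _ : Fin n => d.support.finite_toSet)).subset ?_
  rintro w rfl j
  rw [Finset.mem_coe, Finsupp.mem_support_iff, content_apply, Finset.card_ne_zero]
  exact ⟨j, by simp⟩

/-- The index sequence `i` increases strictly at every descent of `σ`. -/
def Compatible {n : ℕ} (σ : Perm (Fin n)) (i : Fin n → ℕ) : Prop :=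
  ∀ j ∈ Des σ, i ⟨j, by omega⟩ < i ⟨j + 1, by omega⟩

open Classical in
theorem ncard_indexSeqs {n : ℕ} (σ : Perm (Fin n)) {i : Fin n → ℕ} (hi : Monotone i) :
    (indexSeqs n (Des σ) (content i)).ncard = if Compatible σ i then 1 else 0 := by
  have key : ∀ x ∈ indexSeqs n (Des σ) (content i), x = i := fun x hx =>
    eq_of_monotone_of_content_eq hx.1 hi hx.2.2
  split_ifs with h
  · rw [Set.ncard_eq_one]
    refine ⟨i, Set.Subset.antisymm key ?_⟩
    rintro _ rfl
    exact ⟨hi, h, rfl⟩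
  · rw [Set.ncard_eq_zero (indexSeqs_finite _ _ _), Set.eq_empty_iff_forall_notMem]
    intro x hx
    obtain rfl := key x hx
    exact h hx.2.1

open Classical in
theorem coeff_Q {k n : ℕ} (P : Finset (Perm (Fin k))) {i : Fin n → ℕ} (hi : Monotone i) :
    MvPowerSeries.coeff (content i) (Q n P) =
      (Finset.univ.filter fun σ : Perm (Fin n) => Avoids σ P ∧ Compatible σ i).card := by
  rw [Q, map_sum]
  change ∑ σ : Perm (Fin n) with Avoids σ P, ((indexSeqs n (Des σ) (content i)).ncard : ℝ) = _
  simp only [ncard_indexSeqs _ hi]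
  rw [← Finset.filter_filter, Finset.card_filter, Nat.cast_sum]

open Classical in
theorem coeff_Q_eq_zero {k n : ℕ} (P : Finset (Perm (Fin k))) {d : ℕ →₀ ℕ}
    (hd : ∀ i : Fin n → ℕ, content i ≠ d) : MvPowerSeries.coeff d (Q n P) = 0 := by
  rw [Q, map_sum]
  change ∑ σ : Perm (Fin n) with Avoids σ P, ((indexSeqs n (Des σ) d).ncard : ℝ) = _
  refine Finset.sum_eq_zero fun σ _ => ?_
  rw [Nat.cast_eq_zero, Set.ncard_eq_zero (indexSeqs_finite _ _ _),
    Set.eq_empty_iff_forall_notMem]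
  exact fun x hx => hd x hx.2.2

theorem coeff_renameEquiv (f : MvPowerSeries ℕ ℝ) (e : Perm ℕ) (d : ℕ →₀ ℕ) :
    MvPowerSeries.coeff (d.embDomain e.toEmbedding) (MvPowerSeries.renameEquiv (R := ℝ) e f) =
      MvPowerSeries.coeff d f :=
  MvPowerSeries.coeff_embDomain_rename e.toEmbedding f d

theorem isSymmetricFunction_Q_iff {k n : ℕ} (P : Finset (Perm (Fin k))) :
    IsSymmetricFunction (Q n P) ↔ ∀ (e : Perm ℕ) (w : Fin n → ℕ),
      MvPowerSeries.coeff (content (e ∘ w)) (Q n P) =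
        MvPowerSeries.coeff (content w) (Q n P) := by
  have emb := fun e : Perm ℕ => content_comp_left (n := n) e.toEmbedding
  simp only [Equiv.coe_toEmbedding] at emb
  constructor
  · rintro ⟨-, h⟩ e w
    conv_lhs => rw [← h e]
    rw [emb, coeff_renameEquiv]
  -- `Q n P` is homogeneous of degree `n`, so bounded degree costs nothing; only monomials that are
  -- contents of words of length `n` need the hypothesis.
  · refine fun h => ⟨⟨n, fun d hd => coeff_Q_eq_zero P fun i hi => ?_⟩, fun e => ?_⟩
    · rw [← hi, degree_content] at hd
      exact hd.false
    · ext d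
      obtain ⟨d, rfl⟩ : ∃ d', d = Finsupp.embDomain e.toEmbedding d' :=
        ⟨d.embDomain e.symm.toEmbedding, by
          ext v
          obtain ⟨u, rfl⟩ := e.surjective v
          have h1 := Finsupp.embDomain_apply_self e.toEmbedding
            (d.embDomain e.symm.toEmbedding) u
          have h2 := Finsupp.embDomain_apply_self e.symm.toEmbedding d (e u)
          simp only [Equiv.coe_toEmbedding, Equiv.symm_apply_apply] at h1 h2
          rw [h1, h2]⟩
      rw [coeff_renameEquiv]
      by_cases hd : ∃ i : Fin n → ℕ, content i = d
      · obtain ⟨i, rfl⟩ := hd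
        rw [← h e, emb]
      · push Not at hd
        rw [coeff_Q_eq_zero P hd, coeff_Q_eq_zero]
        intro i hi
        refine hd (e.symm ∘ i) ?_
        have : i = e ∘ (e.symm ∘ i) := by ext; simp
        rw [this, emb] at hi
        exact Finsupp.embDomain_injective _ hi

theorem compatible_comp_sort {n : ℕ} (w : Fin n → ℕ) :
    Compatible (Tuple.sort w) (w ∘ Tuple.sort w) := by
  intro j hj
  refine lt_of_le_of_ne (Tuple.monotone_sort w (by simp [Fin.le_def])) fun h => ?_
  exact (lt_asymm ((Tuple.eq_sort_iff.mp rfl).2 _ _ (by simp [Fin.lt_def]) h)) hj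

/-- Compatibility forbids descents of `σ` inside a block of equal letters of `i`, so `σ` increases
on each block. This is the tie-breaking rule that singles out `Tuple.sort` among all permutations
sorting `i ∘ σ.symm`. -/
theorem Compatible.sort_eq {n : ℕ} {σ : Perm (Fin n)} {i : Fin n → ℕ} (hi : Monotone i)
    (h : Compatible σ i) : Tuple.sort (i ∘ σ.symm) = σ := by
  symm
  rw [Tuple.eq_sort_iff]
  have hc : (i ∘ σ.symm) ∘ σ = i := by ext; simp
  refine ⟨by rwa [hc], fun a b hab hi' => ?_⟩
  simp only [Function.comp_apply, Equiv.symm_apply_apply] at hi'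
  obtain ⟨a, ha⟩ := a
  obtain ⟨b, hb⟩ := b
  rw [Fin.mk_lt_mk] at hab
  induction b, (Nat.succ_le_of_lt hab) using Nat.le_induction with
  | base =>
    by_contra hlt
    have hne : σ ⟨a + 1, hb⟩ ≠ σ ⟨a, ha⟩ := by simp
    have : (⟨a, by omega⟩ : Fin (n - 1)) ∈ Des σ := lt_of_le_of_ne (not_lt.mp hlt) hne
    exact (h _ this).ne hi'
  | succ b hab' ih =>
    have e1 : i ⟨a, ha⟩ ≤ i ⟨b, by omega⟩ := hi (by simp only [Fin.mk_le_mk]; omega)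
    have e2 : i ⟨b, by omega⟩ ≤ i ⟨b + 1, hb⟩ := hi (by simp)
    refine (ih (by omega) (by omega) (le_antisymm e1 (hi' ▸ e2))).trans ?_
    by_contra hlt
    have hne : σ ⟨b + 1, hb⟩ ≠ σ ⟨b, by omega⟩ := by simp
    have : (⟨b, by omega⟩ : Fin (n - 1)) ∈ Des σ := lt_of_le_of_ne (not_lt.mp hlt) hne
    exact (h _ this).ne (le_antisymm e2 (hi' ▸ e1))

open Classical in
/-- Permutations compatible with `i` correspond to the rearrangements of `i`. -/
theorem card_compatible {n : ℕ} (p : Perm (Fin n) → Prop) {i : Fin n → ℕ} (hi : Monotone i) :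
    (Finset.univ.filter fun σ : Perm (Fin n) => p σ ∧ Compatible σ i).card =
      {w : Fin n → ℕ | content w = content i ∧ p (Tuple.sort w)}.ncard := by
  rw [← Set.ncard_coe_finset]
  refine Set.ncard_congr (fun σ _ => i ∘ σ.symm) ?_ ?_ ?_
  · intro σ hσ
    simp only [Finset.coe_filter, Finset.mem_univ, true_and, Set.mem_ofPred_eq] at hσ
    exact ⟨content_comp_perm i σ.symm, by rw [hσ.2.sort_eq hi]; exact hσ.1⟩
  · intro σ τ hσ hτ h
    simp only [Finset.coe_filter, Finset.mem_univ, true_and, Set.mem_ofPred_eq] at hσ hτ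
    rw [← hσ.2.sort_eq hi, ← hτ.2.sort_eq hi, h]
  · rintro w ⟨hw, hp⟩
    have hs : w ∘ Tuple.sort w = i := eq_of_monotone_of_content_eq (Tuple.monotone_sort w) hi
      (by rw [content_comp_perm, hw])
    refine ⟨Tuple.sort w, ?_, ?_⟩
    · simp only [Finset.coe_filter, Finset.mem_univ, true_and, Set.mem_ofPred_eq]
      exact ⟨hp, hs ▸ compatible_comp_sort w⟩
    · rw [← hs]
      ext
      simp

theorem coeff_Q_eq_ncard {k n : ℕ} (P : Finset (Perm (Fin k))) (w : Fin n → ℕ) :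
    MvPowerSeries.coeff (content w) (Q n P) =
      ({v : Fin n → ℕ | content v = content w ∧ Avoids (Tuple.sort v) P}.ncard : ℝ) := by
  rw [← content_comp_perm w (Tuple.sort w), coeff_Q P (Tuple.monotone_sort w),
    card_compatible _ (Tuple.monotone_sort w)]

-- Without the avoidance condition all rearrangements count, and `e` permutes the letters
-- bijectively: the sum of `F_{Des σ}` over all of 𝔖ₙ is symmetric.
open Classical in
theorem card_compatible_comp {n : ℕ} {i i' : Fin n → ℕ} (hi : Monotone i) (hi' : Monotone i')
    (e : Perm ℕ) (h : content i' = content (e ∘ i)) :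
    (Finset.univ.filter fun σ : Perm (Fin n) => Compatible σ i').card =
      (Finset.univ.filter fun σ : Perm (Fin n) => Compatible σ i).card := by
  have h1 := card_compatible (fun _ => True) hi
  have h2 := card_compatible (fun _ => True) hi'
  simp only [true_and, and_true] at h1 h2
  rw [h1, h2]
  symm
  refine Set.ncard_congr (fun w _ => e ∘ w) ?_ ?_ ?_
  · intro w hw
    simp only [Set.mem_ofPred_eq] at hw ⊢
    rw [h, content_comp_eq_iff, hw]
  · intro w v _ _ hwv
    exact e.injective.comp_left hwv
  · intro w hw
    have : w = e ∘ (e.symm ∘ w) := by ext; simp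
    refine ⟨e.symm ∘ w, ?_, this.symm⟩
    simp only [Set.mem_ofPred_eq] at hw ⊢
    rwa [h, this, content_comp_eq_iff] at hw

open Classical in
theorem IsSymmetricFunction.card_eq {k n : ℕ} {P : Finset (Perm (Fin k))}
    (hs : IsSymmetricFunction (Q n P)) {i i' : Fin n → ℕ} (hi : Monotone i) (hi' : Monotone i')
    (e : Perm ℕ) (h : content i' = content (e ∘ i)) :
    (Finset.univ.filter fun σ : Perm (Fin n) => Avoids σ P ∧ Compatible σ i').card =
      (Finset.univ.filter fun σ : Perm (Fin n) => Avoids σ P ∧ Compatible σ i).card := by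
  have := (isSymmetricFunction_Q_iff P).mp hs e i
  rw [← h, coeff_Q P hi, coeff_Q P hi'] at this
  exact_mod_cast this

/-! ### Bracketing and the crystal operator -/

/-- The number of positions in `[l, r)` at which `w` has the letter `c`. -/
def occurrences {n : ℕ} (w : Fin n → ℕ) (c l r : ℕ) : ℕ :=
  (Finset.univ.filter fun x : Fin n => l ≤ x ∧ (x : ℕ) < r ∧ w x = c).card

theorem occurrences_add {n : ℕ} (w : Fin n → ℕ) (c : ℕ) {l m r : ℕ} (h₁ : l ≤ m) (h₂ : m ≤ r) :
    occurrences w c l r = occurrences w c l m + occurrences w c m r := by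
  rw [occurrences, occurrences, occurrences, ← Finset.card_union_of_disjoint]
  · congr 1
    ext x
    simp only [Finset.mem_filter, Finset.mem_univ, true_and, Finset.mem_union]
    omega
  · rw [Finset.disjoint_left]
    intro x
    simp only [Finset.mem_filter, Finset.mem_univ, true_and]
    omega

theorem occurrences_self {n : ℕ} (w : Fin n → ℕ) (c l : ℕ) : occurrences w c l l = 0 := by
  simp only [occurrences, Finset.card_eq_zero, Finset.filter_eq_empty_iff]
  omega

theorem occurrences_singleton {n : ℕ} (w : Fin n → ℕ) (c : ℕ) (j : Fin n) :
    occurrences w c j (j + 1) = if w j = c then 1 else 0 := by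
  split_ifs with h
  · rw [occurrences, Finset.card_eq_one]
    refine ⟨j, ?_⟩
    ext x
    simp only [Finset.mem_filter, Finset.mem_univ, true_and, Finset.mem_singleton, Fin.ext_iff]
    constructor
    · omega
    · intro hx
      obtain rfl : x = j := Fin.ext hx
      exact ⟨le_rfl, Nat.lt_succ_self _, h⟩
  · simp only [occurrences, Finset.card_eq_zero, Finset.filter_eq_empty_iff]
    rintro x - ⟨h1, h2, h3⟩
    obtain rfl : x = j := Fin.ext (by omega)
    exact h h3

theorem occurrences_congr {n : ℕ} {w w' : Fin n → ℕ} {l r : ℕ}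
    (h : ∀ x : Fin n, l ≤ x → (x : ℕ) < r → w x = w' x) (c : ℕ) :
    occurrences w c l r = occurrences w' c l r := by
  unfold occurrences
  congr 1
  ext x
  simp only [Finset.mem_filter, Finset.mem_univ, true_and]
  constructor <;> rintro ⟨h1, h2, h3⟩ <;> refine ⟨h1, h2, ?_⟩
  · rw [← h x h1 h2, h3]
  · rw [h x h1 h2, h3]

theorem occurrences_zero_length {n : ℕ} (w : Fin n → ℕ) (c : ℕ) :
    occurrences w c 0 n = content w c := by
  rw [content_apply, occurrences]
  simp

/-- The crystal operator: `w'` arises from `w` by raising the last `a` that is not bracketed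
with an `a + 1` to the left of it; this letter stands at the position `j`. -/
structure RaisesAt {n : ℕ} (a : ℕ) (j : Fin n) (w w' : Fin n → ℕ) : Prop where
  left_apply : w j = a
  right_apply : w' j = a + 1
  eq_of_ne : ∀ x, x ≠ j → w x = w' x
  before : ∀ l ≤ (j : ℕ), occurrences w (a + 1) l j ≤ occurrences w a l j
  after : ∀ r ≤ n, (j : ℕ) + 1 ≤ r → occurrences w a (j + 1) r ≤ occurrences w (a + 1) (j + 1) r

namespace RaisesAt

variable {n a : ℕ} {j j' : Fin n} {w w' v : Fin n → ℕ}

theorem before' (h : RaisesAt a j w w') (l : ℕ) (hl : l ≤ j) :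
    occurrences w' (a + 1) l j ≤ occurrences w' a l j := by
  have e := occurrences_congr (w := w) (w' := w') (l := l) (r := j)
    fun x _ hx => h.eq_of_ne x (by rintro rfl; omega)
  rw [← e, ← e]
  exact h.before l hl

theorem after' (h : RaisesAt a j w w') (r : ℕ) (hr : r ≤ n) (hj : (j : ℕ) + 1 ≤ r) :
    occurrences w' a (j + 1) r ≤ occurrences w' (a + 1) (j + 1) r := by
  have e := occurrences_congr (w := w) (w' := w') (l := j + 1) (r := r)
    fun x hx _ => h.eq_of_ne x (by rintro rfl; omega)
  rw [← e, ← e]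
  exact h.after r hr hj

/-- If `j < j'`, `before` at `j'` gives at least as many `a` as `a + 1` strictly between them, while
`after` at `j`, read up to and including the `a` at `j'`, gives strictly fewer. -/
theorem not_lt_of_left (h : RaisesAt a j w w') (h' : RaisesAt a j' w v) : ¬ j < j' := by
  intro hlt
  have h1 := h'.before (j + 1) hlt
  have h2 := h.after (j' + 1) j'.isLt (by omega)
  have hlt' : (j : ℕ) + 1 ≤ j' := hlt
  rw [occurrences_add w _ hlt' (Nat.le_succ _), occurrences_add w _ hlt' (Nat.le_succ _),
    occurrences_singleton, occurrences_singleton, h'.left_apply] at h2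
  simp at h2
  omega

theorem right_unique (h : RaisesAt a j w w') (h' : RaisesAt a j' w v) : w' = v := by
  obtain rfl : j = j' := le_antisymm (not_lt.mp (h'.not_lt_of_left h))
    (not_lt.mp (h.not_lt_of_left h'))
  ext x
  by_cases hx : x = j
  · rw [hx, h.right_apply, h'.right_apply]
  · rw [← h.eq_of_ne x hx, h'.eq_of_ne x hx]

theorem not_lt_of_right (h : RaisesAt a j w w') (h' : RaisesAt a j' v w') : ¬ j < j' := by
  intro hlt
  have hlt' : (j : ℕ) + 1 ≤ j' := hlt
  have h1 := h'.before' j (by omega)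
  have h2 := h.after' j' j'.isLt.le hlt'
  rw [occurrences_add w' _ (Nat.le_succ j) hlt', occurrences_add w' _ (Nat.le_succ j) hlt',
    occurrences_singleton, occurrences_singleton, h.right_apply] at h1
  simp at h1
  omega

theorem left_unique (h : RaisesAt a j w w') (h' : RaisesAt a j' v w') : w = v := by
  obtain rfl : j = j' := le_antisymm (not_lt.mp (h'.not_lt_of_right h))
    (not_lt.mp (h.not_lt_of_right h'))
  ext x
  by_cases hx : x = j
  · rw [hx, h.left_apply, h'.left_apply]
  · rw [h.eq_of_ne x hx, ← h'.eq_of_ne x hx]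

theorem content_add (h : RaisesAt a j w w') :
    content w + Finsupp.single (a + 1) 1 = content w' + Finsupp.single a 1 := by
  unfold content
  rw [← Finset.add_sum_erase _ _ (Finset.mem_univ j),
    ← Finset.add_sum_erase _ (fun j => Finsupp.single (w' j) 1) (Finset.mem_univ j),
    h.left_apply, h.right_apply,
    Finset.sum_congr rfl fun x hx => by rw [h.eq_of_ne x (Finset.ne_of_mem_erase hx)]]
  abel

/-- The largest excess of `a` over `a + 1` in a prefix is the number of unbracketed `a`. The
parameter `s` records how many raisings remain possible afterwards, as needed for iteration. -/
theorem exists_right {s : ℕ} (h : ∃ t ≤ n, occurrences w (a + 1) 0 t + s + 1 ≤ occurrences w a 0 t) :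
    ∃ j w', RaisesAt a j w w' ∧
      ∃ t ≤ n, occurrences w' (a + 1) 0 t + s ≤ occurrences w' a 0 t := by
  obtain ⟨t, ht, hst⟩ := h
  set f : ℕ → ℤ := fun t => occurrences w a 0 t - occurrences w (a + 1) 0 t with hf
  obtain ⟨u, hu, hmax⟩ := Finset.exists_max_image (Finset.range (n + 1)) f ⟨0, by simp⟩
  -- The shortest prefix of maximal excess ends in the last unbracketed `a`: minimality of `m`
  -- yields `before`, maximality of `f m` yields `after`.
  obtain ⟨m, hm, hmin⟩ := Finset.exists_min_image
    ((Finset.range (n + 1)).filter fun m => f m = f u) id ⟨u, by simpa using hu⟩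
  simp only [Finset.mem_filter, Finset.mem_range, id] at hm hmin hmax hu
  have hfm : (s : ℤ) + 1 ≤ f m := by
    have := hmax t (by omega)
    simp only [hf] at this hm ⊢
    omega
  have hm0 : m ≠ 0 := by
    rintro rfl
    simp only [hf, occurrences_self] at hfm
    omega
  obtain ⟨j, rfl⟩ := Nat.exists_eq_succ_of_ne_zero hm0
  have hlt : ∀ l ≤ j, f l < f (j + 1) := fun l hl => by
    rw [hm.2]
    exact lt_of_le_of_ne (hmax l (by omega)) fun h => by have := hmin l ⟨by omega, h⟩; omega
  have step : ∀ c, occurrences w c 0 (j + 1) = occurrences w c 0 j + _ := fun c => by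
    rw [occurrences_add w c (Nat.zero_le j) (Nat.le_succ j),
      occurrences_singleton w c ⟨j, by omega⟩]
  have hj := hlt j le_rfl
  have hwj : w ⟨j, by omega⟩ = a := by
    by_contra hne
    simp only [hf, step, if_neg hne] at hj
    push_cast at hj
    omega
  simp only [Nat.succ_eq_add_one, hf, step, hwj] at hfm
  simp at hfm
  have agree : ∀ x : Fin n, x ≠ ⟨j, by omega⟩ →
      w x = Function.update w ⟨j, by omega⟩ (a + 1) x := fun x hx => by
    rw [Function.update_of_ne hx]
  refine ⟨⟨j, by omega⟩, Function.update w ⟨j, by omega⟩ (a + 1),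
    ⟨hwj, by simp, agree, ?_, ?_⟩, j, by omega, ?_⟩
  · intro l hl
    have h1 := hlt l hl
    simp only [hf, step, hwj] at h1
    simp only at hl ⊢
    rw [occurrences_add w _ (Nat.zero_le l) hl, occurrences_add w _ (Nat.zero_le l) hl] at h1
    simp at h1
    omega
  · intro r hr hjr
    have h1 := hmax r (by omega)
    rw [← hm.2] at h1
    simp only [hf, Nat.succ_eq_add_one] at h1
    simp only at hjr ⊢
    rw [occurrences_add w _ (Nat.zero_le _) hjr, occurrences_add w _ (Nat.zero_le _) hjr] at h1
    push_cast at h1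
    omega
  · have e := occurrences_congr (l := 0) (r := j) fun x _ hx =>
      agree x (by rintro rfl; simp at hx)
    rw [← e, ← e]
    omega

theorem exists_left {s : ℕ}
    (h : ∃ t ≤ n, occurrences w' a t n + s + 1 ≤ occurrences w' (a + 1) t n) :
    ∃ j w, RaisesAt a j w w' ∧
      ∃ t ≤ n, occurrences w a t n + s ≤ occurrences w (a + 1) t n := by
  obtain ⟨t, ht, hst⟩ := h
  set f : ℕ → ℤ := fun t => occurrences w' (a + 1) t n - occurrences w' a t n with hf
  obtain ⟨u, hu, hmax⟩ := Finset.exists_max_image (Finset.range (n + 1)) f ⟨0, by simp⟩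
  -- Mirror image: the shortest suffix of maximal excess of `a + 1` begins at the letter to be
  -- lowered.
  obtain ⟨j, hm, hmin⟩ := Finset.exists_max_image
    ((Finset.range (n + 1)).filter fun m => f m = f u) id ⟨u, by simpa using hu⟩
  simp only [Finset.mem_filter, Finset.mem_range, id] at hm hmin hmax hu
  have hfm : (s : ℤ) + 1 ≤ f j := by
    have := hmax t (by omega)
    simp only [hf] at this hm ⊢
    omega
  have hjn : j < n := by
    by_contra hjn
    obtain rfl : j = n := by omega
    simp only [hf, occurrences_self] at hfm
    omega
  have hlt : ∀ r ≤ n, j + 1 ≤ r → f r < f j := fun r hr hjr => by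
    rw [hm.2]
    exact lt_of_le_of_ne (hmax r (by omega)) fun h => by have := hmin r ⟨by omega, h⟩; omega
  have step : ∀ c, occurrences w' c j n = _ + occurrences w' c (j + 1) n := fun c => by
    rw [occurrences_add w' c (Nat.le_succ j) hjn, occurrences_singleton w' c ⟨j, by omega⟩]
  have hj := hlt (j + 1) hjn le_rfl
  have hwj : w' ⟨j, by omega⟩ = a + 1 := by
    by_contra hne
    simp only [hf, step, if_neg hne] at hj
    push_cast at hj
    omega
  simp only [hf, step, hwj] at hfm
  simp at hfm
  have agree : ∀ x : Fin n, x ≠ ⟨j, hjn⟩ →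
      Function.update w' ⟨j, hjn⟩ a x = w' x := fun x hx => by
    rw [Function.update_of_ne hx]
  refine ⟨⟨j, hjn⟩, Function.update w' ⟨j, hjn⟩ a, ⟨by simp, hwj, agree, ?_, ?_⟩,
    j + 1, hjn, ?_⟩
  · intro l hl
    simp only at hl ⊢
    have e := occurrences_congr (l := l) (r := j) fun x _ hx =>
      agree x (by rintro rfl; simp at hx)
    rw [e, e]
    have h1 := hmax l (by omega)
    rw [← hm.2] at h1
    simp only [hf] at h1
    rw [occurrences_add w' _ hl hjn.le, occurrences_add w' _ hl hjn.le] at h1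
    push_cast at h1
    omega
  · intro r hr hjr
    simp only at hjr ⊢
    have e := occurrences_congr (l := j + 1) (r := r) fun x hx _ =>
      agree x (by rintro rfl; simp at hx)
    rw [e, e]
    have h1 := hlt r hr hjr
    simp only [hf, step, hwj] at h1
    rw [occurrences_add w' _ hjr hr, occurrences_add w' _ hjr hr] at h1
    simp at h1
    omega
  · have e := occurrences_congr (l := j + 1) (r := n) fun x hx _ =>
      agree x (by rintro rfl; simp at hx)
    rw [e, e]
    omega

end RaisesAt

/-! ### Raising preserves the existence of long monotone subsequences -/

/-- `w` has a weakly increasing subsequence of length at least `k`. -/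
def HasIncreasing {n : ℕ} (k : ℕ) (w : Fin n → ℕ) : Prop :=
  ∃ s : Finset (Fin n), k ≤ s.card ∧ MonotoneOn w s

/-- `w` has a strictly decreasing subsequence of length at least `k`. -/
def HasDecreasing {n : ℕ} (k : ℕ) (w : Fin n → ℕ) : Prop :=
  ∃ s : Finset (Fin n), k ≤ s.card ∧ StrictAntiOn w s

namespace RaisesAt

variable {n a k : ℕ} {j : Fin n} {w w' : Fin n → ℕ}

/-- After raising position `j`, only the letters `a` of the subsequence to the right of `j` are in
the way. Up to the last of them there are at least as many `a + 1` as `a`, so they can be traded for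
letters `a + 1` without loss of length. -/
theorem hasIncreasing_right (h : RaisesAt a j w w') (hw : HasIncreasing k w) :
    HasIncreasing k w' := by
  obtain ⟨s, hk, hs⟩ := hw
  by_cases hj : j ∈ s
  swap
  · refine ⟨s, hk, fun x hx y hy hxy => ?_⟩
    rw [← h.eq_of_ne x (fun e => hj (e ▸ hx)), ← h.eq_of_ne y (fun e => hj (e ▸ hy))]
    exact hs hx hy hxy
  set A := s.filter fun x => j < x ∧ w x = a with hA
  -- `r` lies just past the last letter in `A`, or just past `j` if there is none. All members of
  -- `s` before `r` are at most `a`, so the new letters `a + 1` in `B` are not already used and fit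
  -- in order.
  obtain ⟨r, hr, hjr, h1, h2⟩ : ∃ r ≤ n, (j : ℕ) + 1 ≤ r ∧ (∀ x ∈ A, (x : ℕ) < r) ∧
      ∀ x ∈ s, (x : ℕ) < r → w x ≤ a := by
    rcases A.eq_empty_or_nonempty with h0 | h0
    · refine ⟨j + 1, j.isLt, le_rfl, by simp [h0], fun x hx hxj => ?_⟩
      rw [← h.left_apply]
      exact hs hx hj (Fin.le_def.mpr (by omega))
    · have hm := Finset.mem_filter.mp (A.max'_mem h0)
      refine ⟨A.max' h0 + 1, (A.max' h0).isLt, ?_, fun x hx => ?_, fun x hx hxr => ?_⟩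
      · have : (j : ℕ) < A.max' h0 := hm.2.1
        omega
      · have : (x : ℕ) ≤ A.max' h0 := A.le_max' x hx
        omega
      · rw [← hm.2.2]
        exact hs hx hm.1 (Fin.le_def.mpr (by omega))
  set B := Finset.univ.filter fun x : Fin n => (j : ℕ) + 1 ≤ x ∧ (x : ℕ) < r ∧ w x = a + 1 with hB
  have hAB : A.card ≤ B.card := by
    refine le_trans (Finset.card_le_card ?_) (h.after r hr hjr)
    intro x hx
    have hx' := Finset.mem_filter.mp hx
    simp only [Finset.mem_filter, Finset.mem_univ, true_and]
    exact ⟨hx'.2.1, h1 x hx, hx'.2.2⟩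
  have hdisj : Disjoint (s \ A) B := by
    rw [Finset.disjoint_left]
    intro x hx hxB
    simp only [hB, Finset.mem_filter, Finset.mem_univ, true_and] at hxB
    have := h2 x (Finset.sdiff_subset hx) hxB.2.1
    omega
  have hsub : A ⊆ s := Finset.filter_subset _ _
  refine ⟨(s \ A) ∪ B, ?_, ?_⟩
  · rw [Finset.card_union_of_disjoint hdisj, Finset.card_sdiff_of_subset hsub]
    omega
  have big : ∀ y ∈ s \ A, j < y → a + 1 ≤ w y := fun y hy hjy => by
    rw [Finset.mem_sdiff, hA, Finset.mem_filter] at hy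
    have h3 : w j ≤ w y := hs hj hy.1 hjy.le
    rw [h.left_apply] at h3
    by_contra hlt
    exact hy.2 ⟨hy.1, hjy, by omega⟩
  intro x hx y hy hxy
  rcases hxy.eq_or_lt with rfl | hxy
  · rfl
  rw [Finset.mem_coe, Finset.mem_union] at hx hy
  have inB : ∀ x ∈ B, j < x ∧ (x : ℕ) < r ∧ w' x = a + 1 := fun x hx => by
    simp only [hB, Finset.mem_filter, Finset.mem_univ, true_and] at hx
    refine ⟨hx.1, hx.2.1, ?_⟩
    rw [← h.eq_of_ne x (by rintro rfl; omega), hx.2.2]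
  rcases hy with hy | hy
  · by_cases hyj : y = j
    · subst hyj
      rcases hx with hx | hx
      · rw [h.right_apply, ← h.eq_of_ne x hxy.ne, ← h.left_apply]
        exact (hs (Finset.sdiff_subset hx) hj hxy.le).trans (Nat.le_succ _)
      · exact absurd (inB x hx).1 hxy.asymm
    · rw [← h.eq_of_ne y hyj]
      rcases hx with hx | hx
      · by_cases hxj : x = j
        · rw [hxj, h.right_apply]
          exact big y hy (hxj ▸ hxy)
        · rw [← h.eq_of_ne x hxj]
          exact hs (Finset.sdiff_subset hx) (Finset.sdiff_subset hy) hxy.le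
      · rw [(inB x hx).2.2]
        exact big y hy ((inB x hx).1.trans hxy)
  · rw [(inB y hy).2.2]
    rcases hx with hx | hx
    · by_cases hxj : x = j
      · rw [hxj, h.right_apply]
      · rw [← h.eq_of_ne x hxj]
        have hxy' : (x : ℕ) < y := hxy
        exact (h2 x (Finset.sdiff_subset hx) (hxy'.trans (inB y hy).2.1)).trans (Nat.le_succ _)
    · rw [(inB x hx).2.2]

/-- Mirror image: the letters `a + 1` of the subsequence to the left of `j` are traded for letters
`a` there. -/
theorem hasIncreasing_left (h : RaisesAt a j w w') (hw : HasIncreasing k w') :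
    HasIncreasing k w := by
  obtain ⟨s, hk, hs⟩ := hw
  by_cases hj : j ∈ s
  swap
  · refine ⟨s, hk, fun x hx y hy hxy => ?_⟩
    rw [h.eq_of_ne x (fun e => hj (e ▸ hx)), h.eq_of_ne y (fun e => hj (e ▸ hy))]
    exact hs hx hy hxy
  set A := s.filter fun x => x < j ∧ w' x = a + 1 with hA
  obtain ⟨l, hl, h1, h2⟩ : ∃ l ≤ (j : ℕ), (∀ x ∈ A, l ≤ (x : ℕ)) ∧
      ∀ x ∈ s, l ≤ (x : ℕ) → a + 1 ≤ w' x := by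
    rcases A.eq_empty_or_nonempty with h0 | h0
    · refine ⟨j, le_rfl, by simp [h0], fun x hx hxj => ?_⟩
      rw [← h.right_apply]
      exact hs hj hx (Fin.le_def.mpr hxj)
    · have hm := Finset.mem_filter.mp (A.min'_mem h0)
      refine ⟨A.min' h0, ?_, fun x hx => A.min'_le x hx, fun x hx hxr => ?_⟩
      · exact hm.2.1.le
      · rw [← hm.2.2]
        exact hs hm.1 hx (Fin.le_def.mpr hxr)
  set B := Finset.univ.filter fun x : Fin n => l ≤ x ∧ (x : ℕ) < j ∧ w' x = a with hB
  have hAB : A.card ≤ B.card := by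
    refine le_trans (Finset.card_le_card ?_) (h.before' l hl)
    intro x hx
    have hx' := Finset.mem_filter.mp hx
    simp only [Finset.mem_filter, Finset.mem_univ, true_and]
    exact ⟨h1 x hx, hx'.2.1, hx'.2.2⟩
  have hdisj : Disjoint (s \ A) B := by
    rw [Finset.disjoint_left]
    intro x hx hxB
    simp only [hB, Finset.mem_filter, Finset.mem_univ, true_and] at hxB
    have := h2 x (Finset.sdiff_subset hx) hxB.1
    omega
  have hsub : A ⊆ s := Finset.filter_subset _ _
  refine ⟨(s \ A) ∪ B, ?_, ?_⟩
  · rw [Finset.card_union_of_disjoint hdisj, Finset.card_sdiff_of_subset hsub]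
    omega
  have small : ∀ y ∈ s \ A, y < j → w' y ≤ a := fun y hy hjy => by
    rw [Finset.mem_sdiff, hA, Finset.mem_filter] at hy
    have h3 : w' y ≤ w' j := hs hy.1 hj hjy.le
    rw [h.right_apply] at h3
    by_contra hlt
    exact hy.2 ⟨hy.1, hjy, by omega⟩
  intro x hx y hy hxy
  rcases hxy.eq_or_lt with rfl | hxy
  · rfl
  rw [Finset.mem_coe, Finset.mem_union] at hx hy
  have inB : ∀ x ∈ B, x < j ∧ l ≤ (x : ℕ) ∧ w x = a := fun x hx => by
    simp only [hB, Finset.mem_filter, Finset.mem_univ, true_and] at hx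
    refine ⟨hx.2.1, hx.1, ?_⟩
    rw [h.eq_of_ne x (by rintro rfl; omega), hx.2.2]
  rcases hx with hx | hx
  · by_cases hxj : x = j
    · subst hxj
      rcases hy with hy | hy
      · rw [h.left_apply, h.eq_of_ne y hxy.ne']
        have h3 : w' x ≤ w' y := hs hj (Finset.sdiff_subset hy) hxy.le
        rw [h.right_apply] at h3
        omega
      · exact absurd (inB y hy).1 hxy.asymm
    · rw [h.eq_of_ne x hxj]
      rcases hy with hy | hy
      · by_cases hyj : y = j
        · rw [hyj, h.left_apply]
          exact small x hx (hyj ▸ hxy)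
        · rw [h.eq_of_ne y hyj]
          exact hs (Finset.sdiff_subset hx) (Finset.sdiff_subset hy) hxy.le
      · rw [(inB y hy).2.2]
        exact small x hx (hxy.trans (inB y hy).1)
  · rw [(inB x hx).2.2]
    rcases hy with hy | hy
    · by_cases hyj : y = j
      · rw [hyj, h.left_apply]
      · rw [h.eq_of_ne y hyj]
        have hxy' : (x : ℕ) < y := hxy
        have := h2 y (Finset.sdiff_subset hy) ((inB x hx).2.1.trans hxy'.le)
        omega
    · rw [(inB y hy).2.2]

/-- Raising position `j` does harm only if the subsequence also uses an `a + 1`, necessarily at some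
`x < j`. That `a + 1` is bracketed with an `a` between `x` and `j`, which can take the place of `j`.
-/
theorem hasDecreasing_right (h : RaisesAt a j w w') (hw : HasDecreasing k w) :
    HasDecreasing k w' := by
  obtain ⟨s, hk, hs⟩ := hw
  by_cases hj : j ∈ s
  swap
  · refine ⟨s, hk, fun x hx y hy hxy => ?_⟩
    rw [← h.eq_of_ne x (fun e => hj (e ▸ hx)), ← h.eq_of_ne y (fun e => hj (e ▸ hy))]
    exact hs hx hy hxy
  have gt : ∀ z ∈ s, z < j → a < w z := fun z hz hzj => h.left_apply ▸ hs hz hj hzj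
  have lt : ∀ z ∈ s, j < z → w z < a := fun z hz hzj => h.left_apply ▸ hs hj hz hzj
  by_cases hb : ∃ x ∈ s, w x = a + 1
  · obtain ⟨x, hx, hxa⟩ := hb
    have hxj : x < j := by
      rcases lt_trichotomy x j with hxj | rfl | hxj
      · exact hxj
      · have := h.left_apply
        omega
      · have := lt x hx hxj
        omega
    have h1 : 0 < occurrences w (a + 1) x j :=
      Finset.card_pos.mpr ⟨x, by simpa [hxa] using hxj⟩
    obtain ⟨y, hy⟩ := Finset.card_pos.mp (h1.trans_le (h.before x (Fin.le_def.mp hxj.le)))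
    simp only [Finset.mem_filter, Finset.mem_univ, true_and] at hy
    obtain ⟨hxy, hyj, hya⟩ := hy
    replace hyj : y < j := hyj
    have hys : y ∉ s := fun hys => by
      have := gt y hys hyj
      omega
    refine ⟨insert y (s.erase j), ?_, ?_⟩
    · rw [Finset.card_insert_of_notMem fun hy => hys (Finset.mem_of_mem_erase hy),
        Finset.card_erase_add_one hj]
      exact hk
    have hy' : w' y = a := by rw [← h.eq_of_ne y hyj.ne, hya]
    intro u hu v hv huv
    simp only [Finset.coe_insert, Finset.coe_erase, Set.mem_insert_iff, Set.mem_sdiff,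
      Finset.mem_coe, Set.mem_singleton_iff] at hu hv
    rcases hu with rfl | ⟨hu, huj⟩
    · rcases hv with rfl | ⟨hv, hvj⟩
      · exact absurd huv (lt_irrefl _)
      · rw [hy', ← h.eq_of_ne v hvj]
        rcases lt_or_gt_of_ne hvj with hvj | hvj
        · have h3 := gt v hv hvj
          have h4 : w v < w x := hs hx hv (lt_of_le_of_lt (Fin.le_def.mpr hxy) huv)
          omega
        · exact lt v hv hvj
    · rcases hv with rfl | ⟨hv, hvj⟩
      · rw [hy', ← h.eq_of_ne u huj]
        exact gt u hu (huv.trans hyj)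
      · rw [← h.eq_of_ne u huj, ← h.eq_of_ne v hvj]
        exact hs hu hv huv
  · push Not at hb
    refine ⟨s, hk, fun u hu v hv huv => ?_⟩
    by_cases huj : u = j
    · subst huj
      rw [h.right_apply, ← h.eq_of_ne v huv.ne']
      exact (lt v hv huv).trans (Nat.lt_succ_self _)
    · rw [← h.eq_of_ne u huj]
      by_cases hvj : v = j
      · subst hvj
        rw [h.right_apply]
        have := gt u hu huv
        have := hb u hu
        omega
      · rw [← h.eq_of_ne v hvj]
        exact hs hu hv huv

/-- Mirror image: an `a` used to the right of `j` forces an `a + 1` between the two, which replaces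
`j`. -/
theorem hasDecreasing_left (h : RaisesAt a j w w') (hw : HasDecreasing k w') :
    HasDecreasing k w := by
  obtain ⟨s, hk, hs⟩ := hw
  by_cases hj : j ∈ s
  swap
  · refine ⟨s, hk, fun x hx y hy hxy => ?_⟩
    rw [h.eq_of_ne x (fun e => hj (e ▸ hx)), h.eq_of_ne y (fun e => hj (e ▸ hy))]
    exact hs hx hy hxy
  have gt : ∀ z ∈ s, z < j → a + 1 < w' z := fun z hz hzj => h.right_apply ▸ hs hz hj hzj
  have lt : ∀ z ∈ s, j < z → w' z < a + 1 := fun z hz hzj => h.right_apply ▸ hs hj hz hzj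
  by_cases hb : ∃ x ∈ s, w' x = a
  · obtain ⟨x, hx, hxa⟩ := hb
    have hxj : j < x := by
      rcases lt_trichotomy j x with hxj | rfl | hxj
      · exact hxj
      · have := h.right_apply
        omega
      · have := gt x hx hxj
        omega
    have hjx : (j : ℕ) + 1 ≤ x := hxj
    have h1 : 0 < occurrences w' a (j + 1) (x + 1) :=
      Finset.card_pos.mpr ⟨x, by simpa [hxa] using hjx⟩
    obtain ⟨y, hy⟩ := Finset.card_pos.mp (h1.trans_le (h.after' (x + 1) x.isLt (by omega)))
    simp only [Finset.mem_filter, Finset.mem_univ, true_and] at hy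
    obtain ⟨hyj, hxy, hya⟩ := hy
    replace hyj : j < y := hyj
    have hys : y ∉ s := fun hys => by
      have := lt y hys hyj
      omega
    refine ⟨insert y (s.erase j), ?_, ?_⟩
    · rw [Finset.card_insert_of_notMem fun hy => hys (Finset.mem_of_mem_erase hy),
        Finset.card_erase_add_one hj]
      exact hk
    have hy' : w y = a + 1 := by rw [h.eq_of_ne y hyj.ne', hya]
    intro u hu v hv huv
    simp only [Finset.coe_insert, Finset.coe_erase, Set.mem_insert_iff, Set.mem_sdiff,
      Finset.mem_coe, Set.mem_singleton_iff] at hu hv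
    rcases hu with rfl | ⟨hu, huj⟩
    · rcases hv with rfl | ⟨hv, hvj⟩
      · exact absurd huv (lt_irrefl _)
      · rw [hy', h.eq_of_ne v hvj]
        exact lt v hv (hyj.trans huv)
    · rcases hv with rfl | ⟨hv, hvj⟩
      · rw [hy', h.eq_of_ne u huj]
        rcases lt_or_gt_of_ne huj with huj | huj
        · exact gt u hu huj
        · have h3 := lt u hu huj
          have huv' : (u : ℕ) < v := huv
          have h4 : w' x < w' u := hs hu hx (Fin.lt_def.mpr (by omega))
          omega
      · rw [h.eq_of_ne u huj, h.eq_of_ne v hvj]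
        exact hs hu hv huv
  · push Not at hb
    refine ⟨s, hk, fun u hu v hv huv => ?_⟩
    by_cases hvj : v = j
    · subst hvj
      rw [h.left_apply, h.eq_of_ne u huv.ne]
      have := gt u hu huv
      omega
    · rw [h.eq_of_ne v hvj]
      by_cases huj : u = j
      · subst huj
        rw [h.left_apply]
        have := lt v hv huv
        have := hb v hv
        omega
      · rw [h.eq_of_ne u huj]
        exact hs hu hv huv

end RaisesAt

/-- `w` has neither a weakly increasing nor a strictly decreasing subsequence of length `k`. -/
def NoLongMonotone {n : ℕ} (k : ℕ) (w : Fin n → ℕ) : Prop :=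
  ¬ HasIncreasing k w ∧ ¬ HasDecreasing k w

theorem RaisesAt.noLongMonotone_iff {n a k : ℕ} {j : Fin n} {w w' : Fin n → ℕ}
    (h : RaisesAt a j w w') : NoLongMonotone k w ↔ NoLongMonotone k w' := by
  rw [NoLongMonotone, NoLongMonotone]
  exact and_congr (not_congr ⟨h.hasIncreasing_right, h.hasIncreasing_left⟩)
    (not_congr ⟨h.hasDecreasing_right, h.hasDecreasing_left⟩)

/-! ### Iterated raising and invariance under permutations of the letters -/

/-- `w'` arises from `w` by `s` applications of the crystal operator. -/
def RaisesPow {n : ℕ} (a : ℕ) : ℕ → (Fin n → ℕ) → (Fin n → ℕ) → Prop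
  | 0, w, w' => w = w'
  | s + 1, w, w' => ∃ j v, RaisesAt a j w v ∧ RaisesPow a s v w'

namespace RaisesPow

variable {n a k : ℕ}

theorem snoc {s : ℕ} {w v w' : Fin n → ℕ} {j : Fin n} (h : RaisesPow a s w v)
    (hv : RaisesAt a j v w') : RaisesPow a (s + 1) w w' := by
  induction s generalizing w with
  | zero =>
    obtain rfl : w = v := h
    exact ⟨j, w', hv, rfl⟩
  | succ s ih =>
    obtain ⟨i, u, hu, h⟩ := h
    exact ⟨i, u, hu, ih h⟩

theorem right_unique {s : ℕ} {w v v' : Fin n → ℕ} (h : RaisesPow a s w v)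
    (h' : RaisesPow a s w v') : v = v' := by
  induction s generalizing w with
  | zero => exact h.symm.trans h'
  | succ s ih =>
    obtain ⟨_, u, hu, h⟩ := h
    obtain ⟨_, u', hu', h'⟩ := h'
    obtain rfl := hu.right_unique hu'
    exact ih h h'

theorem left_unique {s : ℕ} {w v v' : Fin n → ℕ} (h : RaisesPow a s v w)
    (h' : RaisesPow a s v' w) : v = v' := by
  induction s generalizing v v' with
  | zero => exact h.trans h'.symm
  | succ s ih =>
    obtain ⟨_, u, hu, h⟩ := h
    obtain ⟨_, u', hu', h'⟩ := h'
    obtain rfl := ih h h'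
    exact hu.left_unique hu'

theorem noLongMonotone_iff {s : ℕ} {w v : Fin n → ℕ} (h : RaisesPow a s w v) :
    NoLongMonotone k w ↔ NoLongMonotone k v := by
  induction s generalizing w with
  | zero =>
    obtain rfl : w = v := h
    rfl
  | succ s ih =>
    obtain ⟨_, u, hu, h⟩ := h
    rw [hu.noLongMonotone_iff, ih h]

theorem content_add {s : ℕ} {w v : Fin n → ℕ} (h : RaisesPow a s w v) :
    content w + Finsupp.single (a + 1) s = content v + Finsupp.single a s := by
  induction s generalizing w with
  | zero =>
    obtain rfl : w = v := h
    simp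
  | succ s ih =>
    obtain ⟨_, u, hu, h⟩ := h
    rw [Finsupp.single_add, add_comm (Finsupp.single (a + 1) s), ← add_assoc, hu.content_add,
      add_right_comm, ih h, add_assoc, ← Finsupp.single_add]

theorem exists_right {s : ℕ} {w : Fin n → ℕ}
    (h : ∃ t ≤ n, occurrences w (a + 1) 0 t + s ≤ occurrences w a 0 t) :
    ∃ v, RaisesPow a s w v := by
  induction s generalizing w with
  | zero => exact ⟨w, rfl⟩
  | succ s ih =>
    obtain ⟨j, u, hu, h⟩ := RaisesAt.exists_right h
    obtain ⟨v, hv⟩ := ih h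
    exact ⟨v, j, u, hu, hv⟩

theorem exists_left {s : ℕ} {w : Fin n → ℕ}
    (h : ∃ t ≤ n, occurrences w a t n + s ≤ occurrences w (a + 1) t n) :
    ∃ v, RaisesPow a s v w := by
  induction s generalizing w with
  | zero => exact ⟨w, rfl⟩
  | succ s ih =>
    obtain ⟨j, u, hu, h⟩ := RaisesAt.exists_left h
    obtain ⟨v, hv⟩ := ih h
    exact ⟨v, hv.snoc hu⟩

end RaisesPow

theorem content_perm_comp_apply {n : ℕ} (e : Perm ℕ) (w : Fin n → ℕ) (v : ℕ) :
    content (e ∘ w) v = content w (e.symm v) := by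
  simp only [content_apply, Function.comp_apply, Equiv.eq_symm_apply]

/-- The number of rearrangements of `w` without monotone subsequences of length `k`. -/
noncomputable def numNoLongMonotone {n : ℕ} (k : ℕ) (w : Fin n → ℕ) : ℕ :=
  {v : Fin n → ℕ | content v = content w ∧ NoLongMonotone k v}.ncard

/-- With `s` the surplus of `a` over `a + 1`, raising `s` times exchanges the two multiplicities.
`RaisesPow a s` is total and single-valued in both directions between the two sets of words, which
gives both inequalities. -/
theorem numNoLongMonotone_swap_of_le {n k a : ℕ} {w : Fin n → ℕ}
    (h : content w (a + 1) ≤ content w a) :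
    numNoLongMonotone k (swap a (a + 1) ∘ w) = numNoLongMonotone k w := by
  classical
  set w' := swap a (a + 1) ∘ w with hw'
  obtain ⟨s, hs⟩ := Nat.exists_eq_add_of_le h
  have key : content w + Finsupp.single (a + 1) s = content w' + Finsupp.single a s := by
    ext v
    simp only [Finsupp.add_apply, hw', content_perm_comp_apply, symm_swap, Finsupp.single_apply]
    by_cases h1 : v = a
    · subst h1
      simp
      omega
    · by_cases h2 : v = a + 1
      · subst h2
        simp
        omega
      · rw [swap_apply_of_ne_of_ne h1 h2, if_neg (Ne.symm h1), if_neg (Ne.symm h2)]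
  have ha' : content w' a = content w (a + 1) := by
    simp [hw', content_perm_comp_apply]
  have hb' : content w' (a + 1) = content w a := by
    simp [hw', content_perm_comp_apply]
  have fin : ∀ u : Fin n → ℕ, {v : Fin n → ℕ | content v = content u ∧ NoLongMonotone k v}.Finite :=
    fun u => (finite_content_eq (content u)).subset fun v hv => hv.1
  unfold numNoLongMonotone
  rw [Set.ncard_eq_toFinset_card _ (fin w), Set.ncard_eq_toFinset_card _ (fin w')]
  apply le_antisymm
  · refine Finset.card_le_card_of_forall_subsingleton (fun v u => RaisesPow a s u v) ?_ ?_
    · intro v hv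
      rw [Set.Finite.mem_toFinset] at hv
      obtain ⟨u, hu⟩ := RaisesPow.exists_left (a := a) (s := s) (w := v) ⟨0, Nat.zero_le n, by
        rw [occurrences_zero_length, occurrences_zero_length, hv.1]; omega⟩
      refine ⟨u, ?_, hu⟩
      rw [Set.Finite.mem_toFinset]
      have := hu.content_add
      rw [hv.1, ← key] at this
      exact ⟨add_right_cancel this, hu.noLongMonotone_iff.mpr hv.2⟩
    · intro u _ v hv v' hv'
      exact hv.2.right_unique hv'.2
  · refine Finset.card_le_card_of_forall_subsingleton (fun u v => RaisesPow a s u v) ?_ ?_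
    · intro v hv
      rw [Set.Finite.mem_toFinset] at hv
      obtain ⟨u, hu⟩ := RaisesPow.exists_right (a := a) (s := s) (w := v) ⟨n, le_rfl, by
        rw [occurrences_zero_length, occurrences_zero_length, hv.1]; omega⟩
      refine ⟨u, ?_, hu⟩
      rw [Set.Finite.mem_toFinset]
      have := hu.content_add
      rw [hv.1, key] at this
      exact ⟨(add_right_cancel this).symm, hu.noLongMonotone_iff.mp hv.2⟩
    · intro u _ v hv v' hv'
      exact hv.2.left_unique hv'.2

theorem numNoLongMonotone_swap_succ {n : ℕ} (k a : ℕ) (w : Fin n → ℕ) :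
    numNoLongMonotone k (swap a (a + 1) ∘ w) = numNoLongMonotone k w := by
  rcases le_total (content w (a + 1)) (content w a) with h | h
  · exact numNoLongMonotone_swap_of_le h
  · have := numNoLongMonotone_swap_of_le (k := k) (w := swap a (a + 1) ∘ w) (a := a)
      (by simpa [content_perm_comp_apply] using h)
    rw [← this, ← Function.comp_assoc, ← Perm.coe_mul, swap_mul_self, Perm.coe_one,
      Function.id_comp]

theorem numNoLongMonotone_swap {n : ℕ} (k a b : ℕ) (w : Fin n → ℕ) :
    numNoLongMonotone k (swap a b ∘ w) = numNoLongMonotone k w := by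
  wlog hab : a < b generalizing a b
  · rcases (not_lt.mp hab).eq_or_lt with rfl | hba
    · simp
    · rw [swap_comm]
      exact this b a hba
  induction b, (Nat.succ_le_of_lt hab) using Nat.le_induction generalizing w with
  | base => exact numNoLongMonotone_swap_succ k a w
  | succ b hb ih =>
    have : swap a (b + 1) = swap b (b + 1) * (swap a b * swap b (b + 1)) := by
      have hb' : a < b := hb
      rw [← mul_assoc, swap_mul_swap_mul_swap hb'.ne (by omega), swap_comm]
    rw [this, Perm.coe_mul, Perm.coe_mul, Function.comp_assoc, numNoLongMonotone_swap_succ,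
      Function.comp_assoc, ih _ hb, numNoLongMonotone_swap_succ]

theorem numNoLongMonotone_perm {n : ℕ} (k : ℕ) (e : Perm ℕ) (w : Fin n → ℕ) :
    numNoLongMonotone k (e ∘ w) = numNoLongMonotone k w := by
  -- Only the values of `e` on the letters of `w` matter, so `e` may have infinite support. The
  -- induction is on the number of positions whose letter is moved; composing with one transposition
  -- lowers it.
  induction hm : (Finset.univ.filter fun j => e (w j) ≠ w j).card using Nat.strong_induction_on
    generalizing e with
  | _ m ih =>
    by_cases h : ∀ j, e (w j) = w j
    · rw [show e ∘ w = w from funext h]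
    · push Not at h
      obtain ⟨j, hj⟩ := h
      have := ih _ ?_ (swap (w j) (e (w j)) * e) rfl
      · rw [← this, Perm.coe_mul, Function.comp_assoc, numNoLongMonotone_swap]
      · rw [← hm]
        refine Finset.card_lt_card
          ((Finset.ssubset_iff_of_subset fun x hx => ?_).mpr ⟨j, ?_, ?_⟩)
        rotate_left
        · simpa using hj
        · rw [Finset.mem_filter, Perm.mul_apply, swap_apply_right]
          simp
        rw [Finset.mem_filter] at hx ⊢
        refine ⟨Finset.mem_univ x, fun hex => ?_⟩
        replace hx := hx.2
        rw [Perm.mul_apply, hex] at hx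
        refine hx (swap_apply_of_ne_of_ne (fun h => ?_) fun h => ?_)
        · rw [h] at hex
          exact hj hex
        · rw [← hex] at h
          rw [← e.injective h] at hj
          exact hj hex

/-! ### Patterns in the sorting permutation, and sufficiency -/

theorem sort_lt_iff {n : ℕ} (w : Fin n → ℕ) (x y : Fin n) :
    x < y ↔ w (Tuple.sort w x) < w (Tuple.sort w y) ∨
      w (Tuple.sort w x) = w (Tuple.sort w y) ∧ Tuple.sort w x < Tuple.sort w y := by
  have mono := Tuple.monotone_sort w
  have stable := (Tuple.eq_sort_iff (f := w) (σ := Tuple.sort w)).mp rfl |>.2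
  constructor
  · intro h
    rcases (mono h.le).lt_or_eq with h1 | h1
    · exact Or.inl h1
    · exact Or.inr ⟨h1, stable _ _ h h1⟩
  · intro h
    by_contra hxy
    rcases (not_lt.mp hxy).eq_or_lt with rfl | hyx
    · simp at h
    · rcases h with h | ⟨h1, h2⟩
      · exact absurd (mono hyx.le) (not_le.mpr h)
      · exact lt_asymm h2 (stable _ _ hyx h1.symm)

/-- `Tuple.sort w` lists the positions of `w` by increasing letter, ties from left to right. An
increasing run of positions in that list is thus a weakly increasing subsequence of `w`. -/
theorem contains_sort_increasing_iff {n k : ℕ} (w : Fin n → ℕ) :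
    Contains (Tuple.sort w) (increasing k) ↔ HasIncreasing k w := by
  simp only [Contains, increasing, Equiv.refl_apply]
  constructor
  · rintro ⟨f, hf⟩
    refine ⟨Finset.univ.map (f.toEmbedding.trans (Tuple.sort w).toEmbedding), by simp, ?_⟩
    intro x hx y hy hxy
    simp only [Finset.coe_map, Finset.coe_univ, Set.image_univ, Set.mem_range] at hx hy
    obtain ⟨a, rfl⟩ := hx
    obtain ⟨b, rfl⟩ := hy
    simp only [Function.Embedding.trans_apply, Equiv.coe_toEmbedding, RelEmbedding.coe_toEmbedding]
      at hxy ⊢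
    have hab : a ≤ b := by
      rw [← not_lt, hf, not_lt]
      exact hxy
    exact Tuple.monotone_sort w (f.monotone hab)
  · rintro ⟨s, hk, hs⟩
    obtain ⟨t, hts, hk⟩ := Finset.exists_subset_card_eq hk
    set g := t.orderEmbOfFin hk
    have hg : StrictMono fun a => (Tuple.sort w).symm (g a) := by
      intro a b hab
      rw [sort_lt_iff w, Equiv.apply_symm_apply, Equiv.apply_symm_apply]
      have h1 : w (g a) ≤ w (g b) := hs (hts (t.orderEmbOfFin_mem hk a))
        (hts (t.orderEmbOfFin_mem hk b)) (g.monotone hab.le)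
      rcases h1.lt_or_eq with h1 | h1
      · exact Or.inl h1
      · exact Or.inr ⟨h1, g.strictMono hab⟩
    refine ⟨OrderEmbedding.ofStrictMono _ hg, fun a b => ?_⟩
    change a < b ↔ Tuple.sort w ((Tuple.sort w).symm (g a)) <
      Tuple.sort w ((Tuple.sort w).symm (g b))
    rw [Equiv.apply_symm_apply, Equiv.apply_symm_apply, g.lt_iff_lt]

/-- Since equal letters are listed from left to right, positions listed in decreasing order carry
distinct letters; hence strictness. -/
theorem contains_sort_decreasing_iff {n k : ℕ} (w : Fin n → ℕ) :
    Contains (Tuple.sort w) (decreasing k) ↔ HasDecreasing k w := by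
  simp only [Contains, decreasing, Fin.revPerm_apply, Fin.rev_lt_rev]
  constructor
  · rintro ⟨f, hf⟩
    refine ⟨Finset.univ.map (f.toEmbedding.trans (Tuple.sort w).toEmbedding), by simp, ?_⟩
    intro x hx y hy hxy
    simp only [Finset.coe_map, Finset.coe_univ, Set.image_univ, Set.mem_range] at hx hy
    obtain ⟨a, rfl⟩ := hx
    obtain ⟨b, rfl⟩ := hy
    simp only [Function.Embedding.trans_apply, Equiv.coe_toEmbedding, RelEmbedding.coe_toEmbedding]
      at hxy ⊢
    have hab : f b < f a := f.lt_iff_lt.mpr ((hf a b).mpr hxy)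
    rcases (sort_lt_iff w _ _).mp hab with h | ⟨-, h⟩
    · exact h
    · exact absurd hxy h.asymm
  · rintro ⟨s, hk, hs⟩
    obtain ⟨t, hts, hk⟩ := Finset.exists_subset_card_eq hk
    set g := t.orderEmbOfFin hk
    have hg : StrictMono fun a : Fin k => (Tuple.sort w).symm (g a.rev) := by
      intro a b hab
      rw [sort_lt_iff w, Equiv.apply_symm_apply, Equiv.apply_symm_apply]
      exact Or.inl (hs (hts (t.orderEmbOfFin_mem hk _)) (hts (t.orderEmbOfFin_mem hk _))
        (g.strictMono (Fin.rev_lt_rev.mpr hab)))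
    refine ⟨OrderEmbedding.ofStrictMono _ hg, fun a b => ?_⟩
    change b < a ↔ Tuple.sort w ((Tuple.sort w).symm (g a.rev)) <
      Tuple.sort w ((Tuple.sort w).symm (g b.rev))
    rw [Equiv.apply_symm_apply, Equiv.apply_symm_apply, g.lt_iff_lt, Fin.rev_lt_rev]

theorem isSymmetricFunction_Q_increasing_decreasing (n k : ℕ) :
    IsSymmetricFunction (Q n {increasing k, decreasing k}) := by
  rw [isSymmetricFunction_Q_iff]
  intro e w
  have : ∀ v : Fin n → ℕ, Avoids (Tuple.sort v) {increasing k, decreasing k} ↔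
      NoLongMonotone k v := fun v => by
    simp [Avoids, NoLongMonotone, contains_sort_increasing_iff, contains_sort_decreasing_iff]
  rw [coeff_Q_eq_ncard, coeff_Q_eq_ncard]
  simp only [this]
  exact_mod_cast numNoLongMonotone_perm k e w

/-! ### A computable model on lists, and the exceptional case k = 4 -/

/-- The one-line notation of a permutation, with values counted from `0`. -/
def word {n : ℕ} (σ : Perm (Fin n)) : List ℕ := List.ofFn fun x => (σ x : ℕ)

/-- Replace every entry of a list by the number of smaller entries. -/
def standardize (l : List ℕ) : List ℕ := l.map fun x => l.countP (· < x)

/-- The word `l` contains the pattern with one-line notation `p`. -/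
def containsWord (p l : List ℕ) : Bool :=
  (l.sublistsLen p.length).any fun s => standardize s == p

/-- The word `l` is compatible with the index sequence `c`. -/
def compatibleWord (c l : List ℕ) : Bool :=
  -- Both `j` and `j + 1` are below `c.length`, so for `l` of the same length the default of `getD`
  -- is never read.
  (List.range (c.length - 1)).all fun j =>
    l.getD j 0 < l.getD (j + 1) 0 || c.getD j 0 < c.getD (j + 1) 0

/-- The number of words that avoid `p` and `q` and are compatible with `c`. -/
def countAvoiding (p q c : List ℕ) : ℕ :=
  ((List.range c.length).permutations').countP fun l =>
    compatibleWord c l && !(containsWord p l || containsWord q l)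

theorem word_injective {n : ℕ} : Function.Injective (word (n := n)) := by
  intro σ τ h
  ext x
  exact congrFun (List.ofFn_injective h) x

theorem ofFn_val_eq_range (n : ℕ) : (List.ofFn fun x : Fin n => (x : ℕ)) = List.range n := by
  apply List.ext_getElem <;> simp

theorem word_mem_permutations {n : ℕ} (σ : Perm (Fin n)) :
    word σ ∈ (List.range n).permutations' := by
  rw [List.mem_permutations', ← ofFn_val_eq_range]
  exact Equiv.Perm.ofFn_comp_perm σ fun x : Fin n => (x : ℕ)

theorem card_filter_word (n : ℕ) (r : List ℕ → Bool) :
    (Finset.univ.filter fun σ : Perm (Fin n) => r (word σ)).card =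
      ((List.range n).permutations').countP r := by
  have hnd : ((List.range n).permutations').Nodup :=
    (List.permutations_perm_permutations' _).nodup_iff.mp
      (List.nodup_permutations _ List.nodup_range)
  have himg : Finset.univ.image (word (n := n)) = ((List.range n).permutations').toFinset := by
    apply Finset.eq_of_subset_of_card_le
    · intro l hl
      obtain ⟨σ, -, rfl⟩ := Finset.mem_image.mp hl
      exact List.mem_toFinset.mpr (word_mem_permutations σ)
    · rw [Finset.card_image_of_injective _ word_injective, List.toFinset_card_of_nodup hnd,
        ← (List.permutations_perm_permutations' _).length_eq, List.length_permutations]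
      simp [Fintype.card_perm]
  rw [List.countP_eq_length_filter, ← List.toFinset_card_of_nodup (hnd.filter _),
    List.toFinset_filter, ← himg, Finset.filter_image,
    Finset.card_image_of_injective _ word_injective]

theorem countP_ofFn {n : ℕ} {α : Type*} (g : Fin n → α) (r : α → Bool) :
    (List.ofFn g).countP r = (Finset.univ.filter fun x => r (g x)).card := by
  induction n with
  | zero => simp
  | succ n ih =>
    rw [List.ofFn_succ, List.countP_cons, ih, Fin.card_filter_univ_succ, add_comm]
    split_ifs <;> simp [add_comm]

theorem card_filter_lt {k : ℕ} (π : Perm (Fin k)) (a : Fin k) :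
    (Finset.univ.filter fun b => π b < π a).card = π a := by
  rw [← Fin.card_Iio (π a), ← Finset.card_map π.toEmbedding]
  congr 1
  ext b
  simp only [Finset.mem_map_equiv, Finset.mem_filter, Finset.mem_univ, true_and,
    Equiv.apply_symm_apply, Finset.mem_Iio]

theorem standardize_ofFn {k : ℕ} (g : Fin k → ℕ) :
    standardize (List.ofFn g) =
      List.ofFn fun a => (Finset.univ.filter fun b => g b < g a).card := by
  rw [standardize, List.map_ofFn]
  congr 1
  ext a
  simp [countP_ofFn]

theorem lt_iff_card_filter_lt {k : ℕ} (g : Fin k → ℕ) (a b : Fin k) :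
    g a < g b ↔ (Finset.univ.filter fun c => g c < g a).card <
      (Finset.univ.filter fun c => g c < g b).card := by
  constructor
  · intro h
    refine Finset.card_lt_card ((Finset.ssubset_iff_of_subset fun c hc => ?_).mpr ⟨a, ?_, ?_⟩)
    · simp only [Finset.mem_filter, Finset.mem_univ, true_and] at hc ⊢
      exact hc.trans h
    · simpa using h
    · simp
  · intro h
    by_contra hab
    refine absurd (Finset.card_le_card fun c hc => ?_) (not_le.mpr h)
    simp only [Finset.mem_filter, Finset.mem_univ, true_and] at hc ⊢
    omega

theorem contains_iff_containsWord {k n : ℕ} (σ : Perm (Fin n)) (π : Perm (Fin k)) :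
    Contains σ π ↔ containsWord (word π) (word σ) = true := by
  simp only [containsWord, List.any_eq_true, List.mem_sublistsLen, beq_iff_eq]
  constructor
  · rintro ⟨f, hf⟩
    refine ⟨List.ofFn fun a => (σ (f a) : ℕ), ⟨?_, by simp [word]⟩, ?_⟩
    · rw [List.sublist_iff_exists_fin_orderEmbedding_get_eq]
      refine ⟨(Fin.castOrderIso (by simp)).toOrderEmbedding.trans
        (f.trans (Fin.castOrderIso (by simp [word])).toOrderEmbedding), fun x => ?_⟩
      simp only [word, List.get_eq_getElem, List.getElem_ofFn]
      rfl
    · rw [standardize_ofFn, word]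
      congr 1
      ext a
      rw [← card_filter_lt π a]
      simp only [Fin.val_fin_lt, ← hf]
  · rintro ⟨s, ⟨hs, hlen⟩, hst⟩
    obtain ⟨f, hf⟩ := List.sublist_iff_exists_fin_orderEmbedding_get_eq.mp hs
    have hk : s.length = k := by simpa [word] using hlen
    subst hk
    let f' : Fin s.length ↪o Fin n := f.trans
      (Fin.castOrderIso (by simp [word] : (word σ).length = n)).toOrderEmbedding
    have hs' : s = List.ofFn fun a => (σ (f' a) : ℕ) := by
      conv_lhs => rw [← List.ofFn_get s]
      congr 1
      ext a
      rw [hf a]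
      simp only [word, List.get_eq_getElem, List.getElem_ofFn]
      rfl
    refine ⟨f', fun a b => ?_⟩
    have hcard : ∀ a, (π a : ℕ) =
        (Finset.univ.filter fun c => (σ (f' c) : ℕ) < (σ (f' a) : ℕ)).card := fun a => by
      have h1 : standardize s = standardize (List.ofFn fun a => (σ (f' a) : ℕ)) :=
        congrArg standardize hs'
      rw [hst, standardize_ofFn, word] at h1
      exact congrFun (List.ofFn_injective h1) a
    rw [Fin.lt_def, hcard, hcard, ← lt_iff_card_filter_lt fun a => (σ (f' a) : ℕ), Fin.lt_def]

theorem word_getD {n : ℕ} (σ : Perm (Fin n)) (j : ℕ) (hj : j < n) :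
    (word σ).getD j 0 = σ ⟨j, hj⟩ := by
  simp [word, List.getD_eq_getElem?_getD, hj]

theorem compatible_iff_compatibleWord {n : ℕ} {c : List ℕ} (hc : c.length = n)
    (σ : Perm (Fin n)) :
    Compatible σ (fun x => c.getD x 0) ↔ compatibleWord c (word σ) = true := by
  subst hc
  simp only [compatibleWord, List.all_eq_true, List.mem_range, Bool.or_eq_true, decide_eq_true_eq]
  constructor
  · intro h j hj
    rw [or_iff_not_imp_left, word_getD σ j (by omega), word_getD σ (j + 1) (by omega)]
    intro hlt
    refine h ⟨j, hj⟩ (lt_of_le_of_ne (Fin.le_def.mpr (not_lt.mp hlt)) ?_)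
    simp
  · intro h j hj
    have := h j j.isLt
    rw [word_getD σ j (by omega), word_getD σ (j + 1) (by omega)] at this
    exact this.resolve_left (lt_asymm hj)

open Classical in
theorem card_avoids_compatible {k n : ℕ} (p q : Perm (Fin k)) {c : List ℕ} (hc : c.length = n) :
    (Finset.univ.filter fun σ : Perm (Fin n) =>
      Avoids σ {p, q} ∧ Compatible σ (fun x => c.getD x 0)).card =
        countAvoiding (word p) (word q) c := by
  rw [countAvoiding, hc, ← card_filter_word]
  congr 1
  ext σ
  simp only [Finset.mem_filter, Finset.mem_univ, true_and, Bool.and_eq_true, Bool.not_eq_true',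
    Bool.or_eq_false_iff, ← compatible_iff_compatibleWord hc, Avoids, Finset.mem_insert,
    Finset.mem_singleton, forall_eq_or_imp, forall_eq, contains_iff_containsWord,
    Bool.not_eq_true]
  exact and_comm

theorem ofFn_getD {n : ℕ} {c : List ℕ} (hc : c.length = n) :
    (List.ofFn fun x : Fin n => c.getD x 0) = c := by
  subst hc
  conv_rhs => rw [← List.ofFn_get c]
  congr 1
  ext x
  simp

theorem monotone_getD {n : ℕ} {c : List ℕ} (hc : c.length = n) (h : c.Pairwise (· ≤ ·)) :
    Monotone fun x : Fin n => c.getD x 0 := by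
  rw [← ofFn_getD hc, List.pairwise_ofFn] at h
  intro x y hxy
  rcases hxy.eq_or_lt with rfl | hxy
  · rfl
  · exact h hxy

theorem IsSymmetricFunction.countAvoiding_eq {k n : ℕ} {p q : Perm (Fin k)}
    (hs : IsSymmetricFunction (Q n {p, q})) {c c' : List ℕ} (hc : c.length = n)
    (hc' : c'.length = n) (e : Perm ℕ) (h : c'.Perm (c.map e)) (hm : c.Pairwise (· ≤ ·))
    (hm' : c'.Pairwise (· ≤ ·)) :
    countAvoiding (word p) (word q) c' = countAvoiding (word p) (word q) c := by
  classical
  rw [← card_avoids_compatible p q hc, ← card_avoids_compatible p q hc']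
  refine hs.card_eq (monotone_getD hc hm) (monotone_getD hc' hm') e ?_
  rw [content_eq_iff_perm, ofFn_getD hc', ← List.map_ofFn, ofFn_getD hc]
  exact h

/-- Here Des p = {1,3} and Des q = {2}, the pairs that degree 4 cannot exclude. Each equation
compares the coefficients at two monomials whose exponents are rearrangements of each other, in
degree 5 or 6; no such pair satisfies all four. -/
theorem exists_countAvoiding_ne :
    ∀ p ∈ (List.range 4).permutations', ∀ q ∈ (List.range 4).permutations',
      p.getD 1 0 < p.getD 0 0 → ¬ p.getD 2 0 < p.getD 1 0 → p.getD 3 0 < p.getD 2 0 →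
      ¬ q.getD 1 0 < q.getD 0 0 → q.getD 2 0 < q.getD 1 0 → ¬ q.getD 3 0 < q.getD 2 0 →
      countAvoiding p q [0, 0, 1, 2, 2] = countAvoiding p q [0, 1, 1, 2, 2] →
      countAvoiding p q [0, 0, 1, 1, 2] = countAvoiding p q [0, 1, 1, 2, 2] →
      countAvoiding p q [0, 1, 1, 2, 2, 3] = countAvoiding p q [0, 1, 2, 2, 3, 3] →
      countAvoiding p q [0, 0, 1, 2, 2, 3] = countAvoiding p q [0, 1, 2, 2, 3, 3] → False := by
  decide +kernel

theorem not_isSymmetricFunction_of_alternating {p q : Perm (Fin 4)}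
    (hs : ∀ n, IsSymmetricFunction (Q n {p, q}))
    (hp : p 1 < p 0 ∧ ¬ p 2 < p 1 ∧ p 3 < p 2) (hq : ¬ q 1 < q 0 ∧ q 2 < q 1 ∧ ¬ q 3 < q 2) :
    False := by
  have w : ∀ (σ : Perm (Fin 4)) (i j : Fin 4),
      (word σ).getD i 0 < (word σ).getD j 0 ↔ σ i < σ j := fun σ i j => by
    rw [word_getD σ i i.isLt, word_getD σ j j.isLt, Fin.lt_def]
  exact exists_countAvoiding_ne (word p) (word_mem_permutations p) (word q)
    (word_mem_permutations q) ((w p 1 0).mpr hp.1) (mt (w p 2 1).mp hp.2.1) ((w p 3 2).mpr hp.2.2)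
    (mt (w q 1 0).mp hq.1) ((w q 2 1).mpr hq.2.1) (mt (w q 3 2).mp hq.2.2)
    ((hs 5).countAvoiding_eq rfl rfl (swap 0 1) (by decide) (by decide) (by decide))
    ((hs 5).countAvoiding_eq rfl rfl (swap 0 2) (by decide) (by decide) (by decide))
    ((hs 6).countAvoiding_eq rfl rfl (swap 1 3) (by decide) (by decide) (by decide))
    ((hs 6).countAvoiding_eq rfl rfl (swap 0 3) (by decide) (by decide) (by decide))

/-! ### Necessity: descent sets of the two patterns -/

theorem perm_eq_of_lt_iff {k : ℕ} {π σ : Perm (Fin k)}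
    (h : ∀ a b, π a < π b ↔ σ a < σ b) : π = σ := by
  have hm : StrictMono (σ ∘ π.symm) := fun a b hab => by
    rw [Function.comp_apply, Function.comp_apply, ← h]
    simpa using hab
  ext x
  have hx := congrFun hm.eq_id (π x)
  simp only [Function.comp_apply, Equiv.symm_apply_apply, id] at hx
  rw [hx]

theorem contains_iff_eq {k : ℕ} (σ π : Perm (Fin k)) : Contains σ π ↔ σ = π := by
  constructor
  · rintro ⟨f, hf⟩
    have hf' : (f : Fin k → Fin k) = id := f.strictMono.eq_id
    simp only [hf', id] at hf
    exact (perm_eq_of_lt_iff hf).symm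
  · rintro rfl
    exact ⟨RelEmbedding.refl _, fun a b => Iff.rfl⟩

/-- `σ` has a descent at the positions `j`, `j + 1`. -/
def HasDescent {k : ℕ} (σ : Perm (Fin k)) (j : ℕ) : Prop :=
  ∃ h : j + 1 < k, σ ⟨j + 1, h⟩ < σ ⟨j, by omega⟩

theorem compatible_iff_hasDescent {k : ℕ} (σ : Perm (Fin k)) (i : ℕ → ℕ) :
    Compatible σ (fun x => i x) ↔ ∀ j, HasDescent σ j → i j < i (j + 1) :=
  ⟨fun h j hj => h ⟨j, by have := hj.1; omega⟩ hj.2, fun h j hj => h j ⟨by omega, hj⟩⟩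

theorem eq_increasing_of_forall_not_hasDescent {k : ℕ} {σ : Perm (Fin k)}
    (h : ∀ j, j + 1 < k → ¬ HasDescent σ j) : σ = increasing k := by
  have hm : StrictMono σ := by
    cases k with
    | zero => exact Subsingleton.strictMono _
    | succ k =>
      refine Fin.strictMono_iff_lt_succ.mpr fun j => ?_
      refine lt_of_le_of_ne (not_lt.mp fun hlt => h j (by omega) ⟨by omega, hlt⟩) ?_
      simp [Fin.ext_iff]
  exact perm_eq_of_lt_iff fun a b => hm.lt_iff_lt

theorem eq_decreasing_of_forall_hasDescent {k : ℕ} {σ : Perm (Fin k)}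
    (h : ∀ j, j + 1 < k → HasDescent σ j) : σ = decreasing k := by
  have hm : StrictAnti σ := by
    cases k with
    | zero => exact Subsingleton.strictAnti _
    | succ k =>
      exact Fin.strictAnti_iff_succ_lt.mpr fun j => (h j (by omega)).2
  exact perm_eq_of_lt_iff fun a b => by
    rw [hm.lt_iff_gt, decreasing, Fin.revPerm_apply, Fin.revPerm_apply, Fin.rev_lt_rev]

open Classical in
/-- If `Q k P` is symmetric then so is the sum of the `F_{Des π}` over `π ∈ P`. -/
theorem IsSymmetricFunction.card_filter_compatible {k : ℕ} {P : Finset (Perm (Fin k))}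
    (hs : IsSymmetricFunction (Q k P)) {i i' : Fin k → ℕ} (hi : Monotone i) (hi' : Monotone i')
    (e : Perm ℕ) (h : content i' = content (e ∘ i)) :
    (P.filter fun π => Compatible π i').card = (P.filter fun π => Compatible π i).card := by
  -- In degree `k` containment is equality, so the avoiders are the complement of `P`; subtracting
  -- from the symmetric total leaves the sum over `P`.
  have split : ∀ i : Fin k → ℕ, (Finset.univ.filter fun σ : Perm (Fin k) => Compatible σ i).card =
      (P.filter fun π => Compatible π i).card +
        (Finset.univ.filter fun σ : Perm (Fin k) => Avoids σ P ∧ Compatible σ i).card := fun i => by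
    rw [← Finset.card_union_of_disjoint]
    · congr 1
      ext σ
      simp only [Finset.mem_filter, Finset.mem_univ, true_and, Finset.mem_union, Avoids,
        contains_iff_eq]
      by_cases hσ : σ ∈ P
      · simp [hσ]
      · simp only [hσ, false_and, false_or, iff_and_self]
        rintro - π hπ rfl
        exact hσ hπ
    · rw [Finset.disjoint_left]
      simp only [Finset.mem_filter, Finset.mem_univ, true_and, Avoids, contains_iff_eq]
      intro σ h1 h2
      exact h2.1 σ h1.1 rfl
  have h1 := hs.card_eq hi hi' e h
  have h2 := card_compatible_comp hi hi' e h
  rw [split, split] at h2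
  omega

theorem val_swap {k : ℕ} (a b x : Fin k) : ((swap a b x : Fin k) : ℕ) = swap (a : ℕ) b x := by
  simp only [swap_apply_def, Fin.ext_iff]
  split_ifs <;> rfl

-- `A` and `A'` express compatibility with `i` and `i'` as conditions on a descent set, so that
-- equality of two coefficients becomes arithmetic with truth values.
open Classical in
theorem IsSymmetricFunction.compatible_pair {k : ℕ} {p q : Perm (Fin k)} (hpq : p ≠ q)
    (hs : IsSymmetricFunction (Q k {p, q})) {i i' : ℕ → ℕ} (hi : Monotone i) (hi' : Monotone i')
    {a b : ℕ} (ha : a < k) (hb : b < k) (h : ∀ x, i' x = swap a b (i (swap a b x)))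
    {A A' : (ℕ → Prop) → Prop} [DecidablePred A] [DecidablePred A']
    (hA : ∀ d : ℕ → Prop, (∀ j, d j → i j < i (j + 1)) ↔ A d)
    (hA' : ∀ d : ℕ → Prop, (∀ j, d j → i' j < i' (j + 1)) ↔ A' d) :
    ((if A' (HasDescent p) then 1 else 0) + if A' (HasDescent q) then 1 else 0) =
    ((if A (HasDescent p) then 1 else 0) + if A (HasDescent q) then 1 else 0) := by
  -- Exchanging the letters `a` and `b` spoils the order of `i`; transposing the positions `a` and
  -- `b` restores it and leaves the content unchanged.
  have hc : (fun x : Fin k => i' x) = (swap a b ∘ fun x : Fin k => i x) ∘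
      swap (⟨a, ha⟩ : Fin k) ⟨b, hb⟩ := by
    ext x
    simp only [Function.comp_apply, val_swap, h]
  have := hs.card_filter_compatible (i := fun x : Fin k => i x) (i' := fun x : Fin k => i' x)
    (fun x y hxy => hi hxy) (fun x y hxy => hi' hxy) (swap a b) (by rw [hc, content_comp_perm])
  simpa only [Finset.card_filter, Finset.sum_pair hpq, compatible_iff_hasDescent, hA, hA']
    using this

open Classical in
theorem IsSymmetricFunction.pair_single {k : ℕ} {p q : Perm (Fin k)} (hpq : p ≠ q)
    (hs : IsSymmetricFunction (Q k {p, q})) {a : ℕ} (ha : a + 2 < k) :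
    ((if ¬ HasDescent p (a + 1) then 1 else 0) + if ¬ HasDescent q (a + 1) then 1 else 0) =
    ((if ¬ HasDescent p a then 1 else 0) + if ¬ HasDescent q a then 1 else 0) := by
  -- Both sequences are the identity except that `a + 1` is replaced by a neighbour: `i` doubles the
  -- letter `a`, `i'` doubles `a + 2`, so each forbids exactly one descent.
  refine hs.compatible_pair hpq (i := fun x => if x = a + 1 then a else x)
    (i' := fun x => if x = a + 1 then a + 2 else x) (a := a) (b := a + 2)
    (A := fun d => ¬ d a) (A' := fun d => ¬ d (a + 1)) ?_ ?_ (by omega) (by omega) ?_ ?_ ?_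
  · intro x y hxy
    dsimp only
    split_ifs <;> omega
  · intro x y hxy
    dsimp only
    split_ifs <;> omega
  · intro x
    simp only [swap_apply_def]
    split_ifs <;> omega
  · intro d
    refine ⟨fun h hd => by simpa using h a hd, fun h j hj => ?_⟩
    have : j ≠ a := by rintro rfl; exact h hj
    split_ifs <;> omega
  · intro d
    refine ⟨fun h hd => by simpa using h (a + 1) hd, fun h j hj => ?_⟩
    have : j ≠ a + 1 := by rintro rfl; exact h hj
    split_ifs <;> omega

open Classical in
theorem IsSymmetricFunction.pair_adjacent {k : ℕ} {p q : Perm (Fin k)} (hpq : p ≠ q)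
    (hs : IsSymmetricFunction (Q k {p, q})) {a : ℕ} (ha : a + 3 < k) :
    ((if ¬ HasDescent p (a + 1) ∧ ¬ HasDescent p (a + 2) then 1 else 0) +
      if ¬ HasDescent q (a + 1) ∧ ¬ HasDescent q (a + 2) then 1 else 0) =
    ((if ¬ HasDescent p a ∧ ¬ HasDescent p (a + 1) then 1 else 0) +
      if ¬ HasDescent q a ∧ ¬ HasDescent q (a + 1) then 1 else 0) := by
  -- Tripled letters `a` and `a + 3` forbid two adjacent descents each.
  refine hs.compatible_pair hpq (i := fun x => if x = a + 1 ∨ x = a + 2 then a else x)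
    (i' := fun x => if x = a + 1 ∨ x = a + 2 then a + 3 else x) (a := a) (b := a + 3)
    (A := fun d => ¬ d a ∧ ¬ d (a + 1)) (A' := fun d => ¬ d (a + 1) ∧ ¬ d (a + 2))
    ?_ ?_ (by omega) (by omega) ?_ ?_ ?_
  · intro x y hxy
    dsimp only
    split_ifs <;> omega
  · intro x y hxy
    dsimp only
    split_ifs <;> omega
  · intro x
    simp only [swap_apply_def]
    split_ifs <;> omega
  · intro d
    refine ⟨fun h => ⟨fun hd => by simpa using h a hd, fun hd => by simpa using h (a + 1) hd⟩,
      fun h j hj => ?_⟩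
    have : j ≠ a := by rintro rfl; exact h.1 hj
    have : j ≠ a + 1 := by rintro rfl; exact h.2 hj
    split_ifs <;> omega
  · intro d
    refine ⟨fun h => ⟨fun hd => by simpa using h (a + 1) hd,
      fun hd => by simpa using h (a + 2) hd⟩, fun h j hj => ?_⟩
    have : j ≠ a + 1 := by rintro rfl; exact h.1 hj
    have : j ≠ a + 2 := by rintro rfl; exact h.2 hj
    split_ifs <;> omega

open Classical in
theorem IsSymmetricFunction.pair_distant {k : ℕ} {p q : Perm (Fin k)} (hpq : p ≠ q)
    (hs : IsSymmetricFunction (Q k {p, q})) (hk : 4 < k) :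
    ((if ¬ HasDescent p 0 ∧ ¬ HasDescent p 3 then 1 else 0) +
      if ¬ HasDescent q 0 ∧ ¬ HasDescent q 3 then 1 else 0) =
    ((if ¬ HasDescent p 0 ∧ ¬ HasDescent p 2 then 1 else 0) +
      if ¬ HasDescent q 0 ∧ ¬ HasDescent q 2 then 1 else 0) := by
  -- Two doubled letters, 0 with 2 or 0 with 4, forbid two non-adjacent descents each.
  refine hs.compatible_pair hpq (i := fun x => if x = 1 then 0 else if x = 3 then 2 else x)
    (i' := fun x => if x = 1 then 0 else if x = 3 then 4 else x) (a := 2) (b := 4)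
    (A := fun d => ¬ d 0 ∧ ¬ d 2) (A' := fun d => ¬ d 0 ∧ ¬ d 3) ?_ ?_ (by omega) hk ?_ ?_ ?_
  · intro x y hxy
    dsimp only
    split_ifs <;> omega
  · intro x y hxy
    dsimp only
    split_ifs <;> omega
  · intro x
    simp only [swap_apply_def]
    split_ifs <;> omega
  · intro d
    refine ⟨fun h => ⟨fun hd => by simpa using h 0 hd, fun hd => by simpa using h 2 hd⟩,
      fun h j hj => ?_⟩
    have : j ≠ 0 := by rintro rfl; exact h.1 hj
    have : j ≠ 2 := by rintro rfl; exact h.2 hj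
    split_ifs <;> omega
  · intro d
    refine ⟨fun h => ⟨fun hd => by simpa using h 0 hd, fun hd => by simpa using h 3 hd⟩,
      fun h j hj => ?_⟩
    have : j ≠ 0 := by rintro rfl; exact h.1 hj
    have : j ≠ 3 := by rintro rfl; exact h.2 hj
    split_ifs <;> omega

theorem eq_decreasing_increasing_of_hasDescent_zero {k : ℕ} (hk : 4 ≤ k) {p q : Perm (Fin k)}
    (hpq : p ≠ q) (hs : ∀ n, IsSymmetricFunction (Q n {p, q})) (hp : HasDescent p 0)
    (hq : ¬ HasDescent q 0) : p = decreasing k ∧ q = increasing k := by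
  classical
  -- The number of patterns without a descent at `a` does not depend on `a`; it is 1 at 0, so the
  -- descent sets are complementary.
  have compl : ∀ a, a + 1 < k → (HasDescent p a ↔ ¬ HasDescent q a) := by
    intro a ha
    induction a with
    | zero => simp [hp, hq]
    | succ a ih =>
      have h1 := (hs k).pair_single hpq (a := a) ha
      have h2 := ih (by omega)
      by_cases h3 : HasDescent p (a + 1) <;> by_cases h4 : HasDescent q (a + 1) <;>
        by_cases h5 : HasDescent q a <;> simp_all
  by_cases h1 : HasDescent p 1
  -- Now `q` ascends at 0 and 1, so at every adjacent pair of positions exactly one pattern ascends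
  -- twice. As `p` descends at `a + 1`, it must be `q`, and the full and empty descent sets
  -- propagate.
  · have all : ∀ a, a + 2 < k → HasDescent p a ∧ HasDescent p (a + 1) := by
      intro a ha
      induction a with
      | zero => exact ⟨hp, h1⟩
      | succ a ih =>
        obtain ⟨h2, h3⟩ := ih (by omega)
        have h4 := (hs k).pair_adjacent hpq (a := a) ha
        have h5 := (compl a (by omega)).mp h2
        have h6 := (compl (a + 1) (by omega)).mp h3
        have h7 := compl (a + 2) ha
        refine ⟨h3, ?_⟩
        by_contra h8
        simp_all
    have allp : ∀ a, a + 1 < k → HasDescent p a := fun a ha => by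
      cases a with
      | zero => exact hp
      | succ a => exact (all a ha).2
    exact ⟨eq_decreasing_of_forall_hasDescent allp,
      eq_increasing_of_forall_not_hasDescent fun a ha => (compl a ha).mp (allp a ha)⟩
  · exfalso
    have h2 := (hs k).pair_adjacent hpq (a := 0) (by omega)
    have c1 := compl 1 (by omega)
    have c2 := compl 2 (by omega)
    have q1 : HasDescent q 1 := by tauto
    -- No pattern ascends at both 0 and 1, hence none at both 1 and 2.
    have p2 : HasDescent p 2 := by
      by_contra h3
      simp [hp, hq, h1, q1, h3] at h2
    have q2 := c2.mp p2
    rcases hk.eq_or_lt with rfl | hk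
    · refine not_isSymmetricFunction_of_alternating hs ⟨hp.2, fun h => h1 ⟨by omega, h⟩, p2.2⟩
        ⟨fun h => hq ⟨by omega, h⟩, q1.2, fun h => q2 ⟨by omega, h⟩⟩
    -- No pattern ascends at both 2 and 3, so `q` descends at 3. Then `q` ascends at 0 and 2, but
    -- neither pattern ascends at both 0 and 3, against `pair_distant`.
    · have h3 := (hs k).pair_adjacent hpq (a := 1) (by omega)
      have h4 := (hs k).pair_distant hpq hk
      have c3 := compl 3 (by omega)
      by_cases p3 : HasDescent p 3 <;> simp_all

theorem pair_eq_increasing_decreasing {k : ℕ} (hk : 4 ≤ k) {p q : Perm (Fin k)}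
    (hpq : p ≠ q) (hs : ∀ n, IsSymmetricFunction (Q n {p, q})) :
    ({p, q} : Finset (Perm (Fin k))) = {increasing k, decreasing k} := by
  classical
  -- If `p` and `q` agree at 0, the constant count of ascents is 0 or 2, so both descent sets are
  -- full or both are empty, whence `p = q`.
  have const : ∀ a, a + 1 < k → (HasDescent p 0 ↔ HasDescent q 0) →
      (HasDescent p a ↔ HasDescent p 0) ∧ (HasDescent q a ↔ HasDescent p 0) := by
    intro a ha h0
    induction a with
    | zero => exact ⟨Iff.rfl, h0.symm⟩
    | succ a ih =>
      have h1 := (hs k).pair_single hpq (a := a) ha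
      have h2 := ih (by omega)
      by_cases h3 : HasDescent p (a + 1) <;> by_cases h4 : HasDescent q (a + 1) <;>
        by_cases h5 : HasDescent p 0 <;> simp_all
  by_cases hp : HasDescent p 0 <;> by_cases hq : HasDescent q 0
  · refine absurd ?_ hpq
    rw [eq_decreasing_of_forall_hasDescent fun a ha => (const a ha (by tauto)).1.mpr hp,
      eq_decreasing_of_forall_hasDescent fun a ha => (const a ha (by tauto)).2.mpr hp]
  · obtain ⟨rfl, rfl⟩ := eq_decreasing_increasing_of_hasDescent_zero hk hpq hs hp hq
    exact Finset.pair_comm _ _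
  · obtain ⟨rfl, rfl⟩ := eq_decreasing_increasing_of_hasDescent_zero hk hpq.symm
      (fun n => Finset.pair_comm p q ▸ hs n) hq hp
    rfl
  · refine absurd ?_ hpq
    rw [eq_increasing_of_forall_not_hasDescent fun a ha => mt (const a ha (by tauto)).1.mp hp,
      eq_increasing_of_forall_not_hasDescent fun a ha => mt (const a ha (by tauto)).2.mp hp]

end PatternQSym

theorem mainTheorem7 (k : ℕ) (hk : 4 ≤ k) (P : Finset (Equiv.Perm (Fin k))) (hP : P.card = 2) :
    (∀ n : ℕ, PatternQSym.IsSymmetricFunction (PatternQSym.Q n P)) ↔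
      P = {PatternQSym.increasing k, PatternQSym.decreasing k} := by
  constructor
  · intro hs
    obtain ⟨p, q, hpq, rfl⟩ := Finset.card_eq_two.mp hP
    exact PatternQSym.pair_eq_increasing_decreasing hk hpq hs
  · rintro rfl n
    exact PatternQSym.isSymmetricFunction_Q_increasing_decreasing n k
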